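/- Let $b_n=4^n/\binom{2n}{n}$ for $n\ge 0$. For a composition $\mathbf s=(s_1,\dots,s_d)$ of positive integers put $|\mathbf s|=s_1+\dots+s_d$. For fourth roots of unity $z_1,\dots,z_d$ with $(s_1,z_1)\ne(1,1)$, the colored multiple zeta value of level $4$ and weight $|\mathbf s|$ is $$\mathrm{Li}_{\mathbf s}(\mathbf z)=\lim_{M\to\infty}\ \sum_{M\ge n_1>\cdots>n_d>0}\frac{z_1^{n_1}\cdots z_d^{n_d}}{n_1^{s_1}\cdots n_d^{s_d}}\in\mathbb C ;$$ the empty composition ($d=0$) gives the value $1$ in weight $0$. Let $\mathsf{CMZV}^4_w\subset\mathbb C$ be the $\mathbb Q$-span of those of weight exactly $w$, and let $\mathsf{CMZV}^4_{\le w}\otimes\mathbb Q[i]\subset\mathbb C$ denote the $\mathbb Q[i]$-span of those of weight at most $w$. Let $d\ge1$, let $\mathbf s=(s_1,\dots,s_d)$ be positive integers with $s_1\ge 2$, and let each $l_j(n)$ be one of $2n$, $2n+1$, $2n-1$. Put $\delta(l)=0$ if $l(n)=2n$ and $\delta(l)=1$ if $l(n)=2n\pm1$; put $\nu(l)=1$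 if $l(n)=2n-1$ and $\nu(l)=0$ otherwise. For a choice of signs $\succ_1,\dots,\succ_d$, each $\ge$ or $>$, consider, over tuples of nonnegative integers, $$S=\sum_{n_1\,\succ_1\,n_2\,\succ_2\cdots\succ_{d-1}\,n_d\,\succ_d\,0}\ \frac{b_{n_1}}{l_1(n_1)^{s_1}\cdots l_d(n_d)^{s_d}} .$$ In (a)–(c) the signs are the default ones: $\succ_j$ is $\ge$ if $l_j(n)=2n+1$ and $>$ otherwise. In every case below the series converges (unconditionally), and: (a) If every $l_j(n)$ is $2n$ or $2n+1$, then $S\in i^{\delta(l_1)}\,\mathsf{CMZV}^4_{|\mathbf s|}$. (b) If there is no $j\ge2$ with $l_j(n)=2n-1$ and $l_{j-1}(n)=2n$, then $S\in i^{\delta(l_1)}\big(\mathsf{CMZV}^4_{|\mathbf s|}+\nu(l_1)\,\mathsf{CMZV}^4_{|\mathbf s|+1}\big)$. In particular this holds if $l_j(n)\ne 2n$ for all $j$. (c) For arbitrary $l_1,\dots,l_d$, $S\in\mathsf{CMZV}^4_{\le|\mathbf s|+\nu(l_1)}\otimes\mathbb Q[i]$. (d) For arbitrary $l_1,\dots,l_d$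 and an arbitrary choice of each $\succ_j$ as $\ge$ or $>$, one still has $S\in\mathsf{CMZV}^4_{\le|\mathbf s|+\nu(l_1)}\otimes\mathbb Q[i]$, provided the series is defined, i.e. no $l_j(n_j)$ vanishes on the range of summation. -/

import Mathlib

/-- The partial sum `∑_{M ≥ n₁ > ⋯ > n_d > 0} ∏_j z_j ^ {n_j} / n_j ^ {s_j}` of the series defining
the multiple polylogarithm `Li_s(z)`; the indices `1, …, d` are the elements of `Fin d`. -/
noncomputable def polylogPartialSum {d : ℕ} (s : Fin d → ℕ) (z : Fin d → ℂ) (M : ℕ) : ℂ :=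
  open Classical in
  ∑ n ∈ (Fintype.piFinset fun _ : Fin d => Finset.Icc 1 M).filter (fun n => StrictAnti n),
    ∏ j, z j ^ n j / (n j : ℂ) ^ s j

/-- `v = Li_s(z)` is a colored multiple zeta value of level `N` and weight `w`: `s` is a composition
of `w`, the `z_j` are `N`-th roots of unity, `(s₁, z₁) ≠ (1, 1)`, and `v` is the value of the
(in general only conditionally convergent) series `Li_s(z)`, summed in the order of the outermost
index. The empty composition (`d = 0`) contributes the value `1` in weight `0`. -/
def IsCMZV (N w : ℕ) (v : ℂ) : Prop :=
  ∃ (d : ℕ) (s : Fin d → ℕ) (z : Fin d → ℂ),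
    (∀ j, 1 ≤ s j) ∧ (∀ j, z j ^ N = 1) ∧ ∑ j, s j = w ∧
    (∀ h : 0 < d, ¬ (s ⟨0, h⟩ = 1 ∧ z ⟨0, h⟩ = 1)) ∧
    Filter.Tendsto (polylogPartialSum s z) Filter.atTop (nhds v)

/-- The `ℚ`-vector subspace of `ℂ` spanned by the colored multiple zeta values of level `N` and
weight exactly `w`. -/
noncomputable def CMZV (N w : ℕ) : Submodule ℚ ℂ :=
  Submodule.span ℚ {v | IsCMZV N w v}

/-- The `ℚ[i]`-subspace of `ℂ` spanned by the colored multiple zeta values of level `N` and weight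
at most `w`, usually written `CMZV_{≤ w}^N ⊗ ℚ[i]`. -/
noncomputable def CMZVLeGaussian (N w : ℕ) : Submodule (Algebra.adjoin ℚ {Complex.I}) ℂ :=
  Submodule.span (Algebra.adjoin ℚ {Complex.I}) {v | ∃ k ≤ w, IsCMZV N k v}

/-- The three admitted linear forms `2n`, `2n + 1` and `2n - 1`. -/
inductive LinForm : Type
  | even
  | oddPlus
  | oddMinus

/-- The value `l(n)`. -/
def LinForm.eval : LinForm → ℕ → ℤ
  | .even, n => 2 * n
  | .oddPlus, n => 2 * n + 1
  | .oddMinus, n => 2 * n - 1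

/-- `δ(l) = 0` if `l(n) = 2n`, and `δ(l) = 1` if `l(n) = 2n ± 1`. -/
def LinForm.delta : LinForm → ℕ
  | .even => 0
  | .oddPlus => 1
  | .oddMinus => 1

/-- `ν(l) = 1` if `l(n) = 2n - 1`, and `ν(l) = 0` otherwise. -/
def LinForm.nu : LinForm → ℕ
  | .even => 0
  | .oddPlus => 0
  | .oddMinus => 1

/-- The two kinds of inequality, `>` and `≥`, admitted between consecutive summation indices. -/
inductive IneqSign : Type
  | gt
  | ge

/-- `m ≻ n` for the chosen inequality sign. -/
def IneqSign.Holds : IneqSign → ℕ → ℕ → Prop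
  | .gt, m, n => m > n
  | .ge, m, n => m ≥ n

/-- The sign attached to a linear form by default: `≥` for `2n + 1`, and `>` for `2n` and
`2n - 1`. -/
def LinForm.sign : LinForm → IneqSign
  | .even => .gt
  | .oddPlus => .ge
  | .oddMinus => .gt

/-- The entry `n_{j+1}` following `n_j`, with the convention `n_{d+1} = 0`. -/
def nextIndex {d : ℕ} (n : Fin d → ℕ) (j : Fin d) : ℕ :=
  if h : (j : ℕ) + 1 < d then n ⟨(j : ℕ) + 1, h⟩ else 0

/-- The range of summation `n₁ ≻₁ n₂ ≻₂ ⋯ ≻_{d-1} n_d ≻_d 0`. -/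
def summationRange {d : ℕ} (r : Fin d → IneqSign) : Set (Fin d → ℕ) :=
  {n | ∀ j, (r j).Holds (n j) (nextIndex n j)}

/-- `b_n = 4 ^ n / binom(2n, n)`. -/
noncomputable def bCoeff (n : ℕ) : ℝ := 4 ^ n / ((2 * n).choose n : ℝ)

/-- The term `b_{n₁} / (l₁(n₁) ^ {s₁} ⋯ l_d(n_d) ^ {s_d})`. -/
noncomputable def aperyTerm {d : ℕ} (hd : 0 < d) (s : Fin d → ℕ) (l : Fin d → LinForm)
    (n : Fin d → ℕ) : ℝ :=
  bCoeff (n ⟨0, hd⟩) / ∏ j, ((l j).eval (n j) : ℝ) ^ s j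

/-- The Apéry-type series
`∑_{n₁ ≻₁ ⋯ ≻_{d-1} n_d ≻_d 0} b_{n₁} / (l₁(n₁) ^ {s₁} ⋯ l_d(n_d) ^ {s_d})`
converges (unconditionally) to `S`. -/
def HasAperySum {d : ℕ} (hd : 0 < d) (s : Fin d → ℕ) (l : Fin d → LinForm)
    (r : Fin d → IneqSign) (S : ℝ) : Prop :=
  HasSum (fun n : summationRange r => aperyTerm hd s l n) S

/-- Every term of the series is defined: no denominator vanishes on the range of summation. -/
def AperyDefined {d : ℕ} (l : Fin d → LinForm) (r : Fin d → IneqSign) : Prop :=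
  ∀ n ∈ summationRange r, ∀ j, (l j).eval (n j) ≠ 0

/-! Everything rests on (2n+1) b_{n+1} = (2n+2) b_n. For a sequence A put F(y) = ∑ b_n (∑_{m ≤ n}
A_m) y^{2n+1}/(2n+1). The recurrence gives (1 - y²) F' - y F = ∑ b_n A_n y^{2n}, so cos t · F(sin t)
is the primitive in t of ∑ b_n A_n sin^{2n} t (`hasDerivAt_angleInt`). Nested sums built from 2n and
2n+1 with the default signs therefore become iterated integrals of dt, cot t dt, tan t dt, dt / sin
t and dt / (sin t cos t).

Under u = tan (t/2) these are rational combinations of du/u and du/(a - u) with a⁴ = 1, except that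
dt carries a factor i. On Taylor coefficients in u, integration against these forms acts by `divOp`
and `intOp`, which preserve the span of polylogarithm coefficients and raise the weight by one
(`Plain.hasAngleRep`). If the outer exponent is at least 2, the last integration never uses du/(1 -
u), so the series converges at u = 1 and Abel's theorem gives the value (`Plain.exists_hasSum`).

The form 2n - 1 becomes 2n + 1 by shifting an index. Under a preceding 2n + 1 or 2n - 1 this keeps
the weight (`oddPlus_mul_prefixSum_ge_stdSeq_mem`); at the outermost place b_{n+1} = b_n +
b_n/(2n+1) produces a second series, one weight higher (`hasSum_oddMinus`). Otherwise, and for other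
inequality signs, two different forms meet at one index and must be separated by partial fractions,
which lower the weight. `IsTarget.mul_prefixSum_mem` does this once for inner indices and once for
the outer one, where a product of two different first powers cannot be split because the pieces need
not converge; such products are evaluated directly by shifting or telescoping
(`even_mul_oddMinus_mem`, `hasSum_even_mul_oddPlus`). -/

open Finset

/-! ### Multiple series as nested sums -/

/-- The finite set of `m` with `n ≻ m`. -/
def IneqSign.below : IneqSign → ℕ → Finset ℕ
  | .gt, n => Finset.range n
  | .ge, n => Finset.range (n + 1)

theorem IneqSign.mem_below {r : IneqSign} {m n : ℕ} : m ∈ r.below n ↔ r.Holds n m := by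
  cases r <;> simp [IneqSign.below, IneqSign.Holds]

theorem IneqSign.below_subset (r : IneqSign) (n : ℕ) : r.below n ⊆ Finset.range (n + 1) := by
  cases r
  · exact Finset.range_subset_range.2 (Nat.le_succ n)
  · exact subset_rfl

/-- The nested sums `f₁(n) ∑_{n ≻₁ n₂} f₂(n₂) ∑_{n₂ ≻₂ n₃} ⋯`, as a sequence in the outermost index;
the empty list stands for the innermost index, which is fixed to `0`. -/
noncomputable def chainSeq : List ((ℕ → ℝ) × IneqSign) → ℕ → ℝ
  | [] => Pi.single 0 1
  | p :: R => fun n => p.1 n * ∑ m ∈ p.2.below n, chainSeq R m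

/-- The first entry of a tuple, `0` for the empty tuple. -/
def headIndex {d : ℕ} (n : Fin d → ℕ) : ℕ := if h : 0 < d then n ⟨0, h⟩ else 0

theorem cons_mem_summationRange {d : ℕ} (r : Fin (d + 1) → IneqSign) (k : ℕ) (n : Fin d → ℕ) :
    (Fin.cons k n : Fin (d + 1) → ℕ) ∈ summationRange r ↔
      headIndex n ∈ (r 0).below k ∧ n ∈ summationRange (fun j => r j.succ) := by
  rw [IneqSign.mem_below]
  simp only [summationRange, Set.mem_ofPred_eq]
  rw [Fin.forall_fin_succ]
  refine and_congr ?_ (forall_congr' fun j => ?_)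
  · have : nextIndex (Fin.cons k n : Fin (d + 1) → ℕ) 0 = headIndex n := by
      rcases d with _ | d
      · simp [nextIndex, headIndex]
      · simp only [nextIndex, headIndex]
        rw [dif_pos (by simp), dif_pos (by simp)]
        exact Fin.cons_succ (α := fun _ => ℕ) k n 0
    rw [this, Fin.cons_zero]
  · have : nextIndex (Fin.cons k n : Fin (d + 1) → ℕ) j.succ = nextIndex n j := by
      simp only [nextIndex, Fin.val_succ, Nat.add_lt_add_iff_right]
      split_ifs with h
      · exact Fin.cons_succ (α := fun _ => ℕ) k n ⟨j + 1, h⟩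
      · rfl
    rw [this, Fin.cons_succ]

theorem hasSum_prod_of_hasSum_fiber {X : Type*} {F : ℕ × X → ℝ} {g h : ℕ → ℝ}
    (hF : ∀ n, HasSum (fun x => F (n, x)) (g n)) (hA : ∀ n, HasSum (fun x => |F (n, x)|) (h n))
    (hs : Summable h) : HasSum F (∑' n, g n) := by
  have hsumm : Summable F := by
    rw [← summable_norm_iff]
    refine (summable_prod_of_nonneg fun p => norm_nonneg _).2 ⟨fun n => (hA n).summable, ?_⟩
    exact hs.congr fun n => (hA n).tsum_eq.symm
  rw [(HasSum.prod_fiberwise hsumm.hasSum hF).tsum_eq]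
  exact hsumm.hasSum

/-- Fubini, one index at a time. The free weight `φ` makes the induction close: it is b_n in the
application, and the indicator of the admissible next indices in the inductive step. -/
theorem hasSum_chain : ∀ (d : ℕ) (f : Fin d → ℕ → ℝ) (r : Fin d → IneqSign) (φ : ℕ → ℝ),
    Summable (fun n => |φ n| * chainSeq (List.ofFn fun j => (fun n => |f j n|, r j)) n) →
    HasSum ((summationRange r).indicator fun n => φ (headIndex n) * ∏ j, f j (n j))
      (∑' n, φ n * chainSeq (List.ofFn fun j => (f j, r j)) n) := by
  intro d
  induction d with
  | zero =>
    intro f r φ _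
    have h1 : ∑' n, φ n * chainSeq (List.ofFn fun j => (f j, r j)) n = φ 0 := by
      rw [tsum_eq_single 0]
      · simp [chainSeq]
      · intro n hn; simp [chainSeq, hn]
    rw [h1]
    refine Eq.subst (motive := fun t => HasSum _ t) ?_
      (hasSum_unique ((summationRange r).indicator fun n => φ (headIndex n) * ∏ j, f j (n j)))
    rw [Set.indicator_of_mem]
    · simp [headIndex]
    · intro j; exact j.elim0
  | succ d ih =>
    intro f r φ hs
    rw [← (Fin.consEquiv fun _ => ℕ).hasSum_iff]
    have inner : ∀ (g : Fin d → ℕ → ℝ) (n : ℕ) (c : ℝ),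
        HasSum (fun x : Fin d → ℕ => c * (summationRange fun j => r j.succ).indicator
          (fun x => ((r 0).below n : Set ℕ).indicator 1 (headIndex x) * ∏ j, g j (x j)) x)
        (c * ∑ m ∈ (r 0).below n, chainSeq (List.ofFn fun j => (g j, r j.succ)) m) := by
      intro g n c
      refine HasSum.mul_left c ?_
      -- The weight is now a finitely supported indicator, so summability is automatic.
      have h1 := ih g (fun j => r j.succ) (((r 0).below n : Set ℕ).indicator 1)
        (summable_of_ne_finset_zero (s := (r 0).below n) fun m hm => by
          simp [Set.indicator_of_notMem (show m ∉ ((r 0).below n : Set ℕ) from hm)])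
      rw [tsum_eq_sum (s := (r 0).below n) fun m hm => by
          simp [Set.indicator_of_notMem (show m ∉ ((r 0).below n : Set ℕ) from hm)]] at h1
      refine Eq.subst (motive := fun t => HasSum _ t) (Finset.sum_congr rfl fun m hm => ?_) h1
      simp [Set.indicator_of_mem (show m ∈ ((r 0).below n : Set ℕ) from hm)]
    have key : ∀ (g : Fin (d + 1) → ℕ → ℝ) (ψ : ℕ → ℝ) (p : ℕ × (Fin d → ℕ)),
        (summationRange r).indicator (fun n => ψ (headIndex n) * ∏ j, g j (n j))
          (Fin.consEquiv (fun _ => ℕ) p) =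
        (ψ p.1 * g 0 p.1) * (summationRange fun j => r j.succ).indicator
          (fun x => ((r 0).below p.1 : Set ℕ).indicator 1 (headIndex x) *
            ∏ j : Fin d, g j.succ (x j)) p.2 := by
      rintro g ψ ⟨n, x⟩
      have hmem := cons_mem_summationRange r n x
      have hc : Fin.consEquiv (fun _ : Fin (d + 1) => ℕ) (n, x) = Fin.cons n x := rfl
      have hh : headIndex (Fin.cons n x : Fin (d + 1) → ℕ) = n := by simp [headIndex]
      rw [hc]
      by_cases h2 : x ∈ summationRange (fun j => r j.succ)
      · rw [Set.indicator_of_mem h2]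
        by_cases h1 : headIndex x ∈ (r 0).below n
        · rw [Set.indicator_of_mem (hmem.2 ⟨h1, h2⟩),
            Set.indicator_of_mem (show headIndex x ∈ ((r 0).below n : Set ℕ) from h1), hh,
            Fin.prod_univ_succ]
          simp [mul_assoc]
        · rw [Set.indicator_of_notMem (fun h => h1 (hmem.1 h).1),
            Set.indicator_of_notMem (show headIndex x ∉ ((r 0).below n : Set ℕ) from h1)]
          simp
      · rw [Set.indicator_of_notMem h2, Set.indicator_of_notMem (fun h => h2 (hmem.1 h).2),
          mul_zero]
    have h1 := hasSum_prod_of_hasSum_fiber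
      (F := ((summationRange r).indicator fun n => φ (headIndex n) * ∏ j, f j (n j)) ∘
          (Fin.consEquiv fun _ => ℕ))
      (g := fun n => φ n * f 0 n * ∑ m ∈ (r 0).below n,
        chainSeq (List.ofFn fun j : Fin d => (f j.succ, r j.succ)) m)
      (h := fun n => |φ n| * |f 0 n| * ∑ m ∈ (r 0).below n,
        chainSeq (List.ofFn fun j : Fin d => (fun k => |f j.succ k|, r j.succ)) m)
      (fun n => (inner (fun j => f j.succ) n (φ n * f 0 n)).congr_fun
        fun x => key f φ (n, x)) ?_ ?_
    · simpa [List.ofFn_succ, chainSeq, mul_assoc] using h1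
    · intro n
      refine (inner (fun j n => |f j.succ n|) n (|φ n| * |f 0 n|)).congr_fun fun x => ?_
      rw [← key (fun j n => |f j n|) (fun n => |φ n|) (n, x), Function.comp_apply]
      by_cases h : Fin.consEquiv (fun _ : Fin (d + 1) => ℕ) (n, x) ∈ summationRange r
      · rw [Set.indicator_of_mem h, Set.indicator_of_mem h, abs_mul, Finset.abs_prod]
      · rw [Set.indicator_of_notMem h, Set.indicator_of_notMem h, abs_zero]
    · simpa [List.ofFn_succ, chainSeq, mul_assoc] using hs

/-! ### Polynomial decay of nested sums -/

section Decay

variable {E : Type*}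

/-- `‖A n‖ = O((n + 1) ^ (-e))`. -/
def Decays [Norm E] (e : ℝ) (A : ℕ → E) : Prop :=
  ∃ C : ℝ, ∀ n : ℕ, ‖A n‖ ≤ C * ((n : ℝ) + 1) ^ (-e)

theorem sum_rpow_le (n : ℕ) :
    ∑ m ∈ range n, ((m : ℝ) + 1) ^ (-(3 / 4) : ℝ) ≤ 4 * (n : ℝ) ^ (1 / 4 : ℝ) := by
  induction n with
  | zero => simp
  | succ n ih =>
    rw [sum_range_succ]
    refine (add_le_add_left ih _).trans ?_
    have hn : (0 : ℝ) ≤ n := n.cast_nonneg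
    obtain ⟨a, ha⟩ : ∃ a : ℝ, a = (n : ℝ) ^ (1 / 4 : ℝ) := ⟨_, rfl⟩
    obtain ⟨b, hb⟩ : ∃ b : ℝ, b = ((n : ℝ) + 1) ^ (1 / 4 : ℝ) := ⟨_, rfl⟩
    have ha0 : 0 ≤ a := ha ▸ Real.rpow_nonneg hn _
    have hb0 : 0 < b := hb ▸ Real.rpow_pos_of_pos (by linarith) _
    have ha4 : a ^ 4 = n := by
      rw [ha, ← Real.rpow_natCast, ← Real.rpow_mul hn]; norm_num
    have hb4 : b ^ 4 = n + 1 := by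
      rw [hb, ← Real.rpow_natCast, ← Real.rpow_mul (by linarith)]; norm_num
    have hb3 : ((n : ℝ) + 1) ^ (-(3 / 4) : ℝ) = (b ^ 3)⁻¹ := by
      rw [hb, ← Real.rpow_natCast, ← Real.rpow_mul (by linarith), ← Real.rpow_neg (by linarith)]
      norm_num
    push_cast
    rw [hb3, ← ha, ← hb]
    have hab : a ≤ b := le_of_pow_le_pow_left₀ (n := 4) (by norm_num) hb0.le (by rw [ha4, hb4]; linarith)
    have h1 : 1 ≤ (b - a) * (4 * b ^ 3) := by
      -- This is b⁴ - a⁴ = 1, factored.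
      have : 1 = (b - a) * (b ^ 3 + b ^ 2 * a + b * a ^ 2 + a ^ 3) := by nlinarith
      rw [this]
      refine mul_le_mul_of_nonneg_left ?_ (by linarith)
      have h2 : b ^ 2 * a ≤ b ^ 2 * b := by gcongr
      have h3 : b * a ^ 2 ≤ b * b ^ 2 := by gcongr
      have h4 : a ^ 3 ≤ b ^ 3 := by gcongr
      nlinarith
    have h5 : (b ^ 3)⁻¹ ≤ 4 * (b - a) := by
      rw [inv_le_iff_one_le_mul₀ (by positivity)]
      linarith
    linarith

theorem norm_sum_le_of_decay [SeminormedAddCommGroup E] {A : ℕ → E} {C : ℝ}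
    (hA : ∀ n : ℕ, ‖A n‖ ≤ C * ((n : ℝ) + 1) ^ (-(3 / 4) : ℝ)) {s : Finset ℕ} {n : ℕ}
    (hs : s ⊆ range (n + 1)) : ‖∑ m ∈ s, A m‖ ≤ 4 * C * ((n : ℝ) + 1) ^ (1 / 4 : ℝ) := by
  have hC : 0 ≤ C := by simpa using (norm_nonneg _).trans (hA 0)
  calc ‖∑ m ∈ s, A m‖ ≤ ∑ m ∈ s, ‖A m‖ := norm_sum_le _ _
    _ ≤ ∑ m ∈ range (n + 1), ‖A m‖ :=
      sum_le_sum_of_subset_of_nonneg hs fun _ _ _ => norm_nonneg _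
    _ ≤ ∑ m ∈ range (n + 1), C * ((m : ℝ) + 1) ^ (-(3 / 4) : ℝ) := sum_le_sum fun m _ => hA m
    _ = C * ∑ m ∈ range (n + 1), ((m : ℝ) + 1) ^ (-(3 / 4) : ℝ) := by rw [mul_sum]
    _ ≤ C * (4 * ((n + 1 : ℕ) : ℝ) ^ (1 / 4 : ℝ)) := by gcongr; exact sum_rpow_le _
    _ = _ := by push_cast; ring

theorem Decays.mul_sum [SeminormedRing E] {A f : ℕ → E} (hA : Decays (3 / 4) A) {k : ℝ}
    (hf : Decays k f) {s : ℕ → Finset ℕ} (hs : ∀ n, s n ⊆ range (n + 1)) :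
    Decays (k - 1 / 4) fun n => f n * ∑ m ∈ s n, A m := by
  obtain ⟨C, hC⟩ := hA
  obtain ⟨D, hD⟩ := hf
  refine ⟨D * (4 * C), fun n => (norm_mul_le _ _).trans ?_⟩
  have h1 : (0 : ℝ) < (n : ℝ) + 1 := by positivity
  have hD0 : 0 ≤ D * ((n : ℝ) + 1) ^ (-k) := (norm_nonneg _).trans (hD n)
  calc ‖f n‖ * ‖∑ m ∈ s n, A m‖
      ≤ (D * ((n : ℝ) + 1) ^ (-k)) * (4 * C * ((n : ℝ) + 1) ^ (1 / 4 : ℝ)) :=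
        mul_le_mul (hD n) (norm_sum_le_of_decay hC (hs n)) (norm_nonneg _) hD0
    _ = D * (4 * C) * (((n : ℝ) + 1) ^ (-k) * ((n : ℝ) + 1) ^ (1 / 4 : ℝ)) := by ring
    _ = _ := by rw [← Real.rpow_add h1]; congr 2; ring

theorem Decays.mono [Norm E] {A : ℕ → E} {k k' : ℝ} (hA : Decays k A) (hk : k' ≤ k)
    (h0 : ∀ n, 0 ≤ ‖A n‖) : Decays k' A := by
  obtain ⟨C, hC⟩ := hA
  have hC0 : 0 ≤ C := by simpa using (h0 0).trans (hC 0)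
  refine ⟨C, fun n => (hC n).trans ?_⟩
  gcongr
  · linarith [(Nat.cast_nonneg n : (0 : ℝ) ≤ n)]

theorem Decays.add [SeminormedAddCommGroup E] {A B : ℕ → E} {k : ℝ} (hA : Decays k A)
    (hB : Decays k B) : Decays k (A + B) := by
  obtain ⟨C, hC⟩ := hA
  obtain ⟨D, hD⟩ := hB
  exact ⟨C + D, fun n => (norm_add_le _ _).trans
    ((add_le_add (hC n) (hD n)).trans (add_mul C D _).ge)⟩

theorem Decays.mul [SeminormedRing E] {A B : ℕ → E} {k l : ℝ} (hA : Decays k A)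
    (hB : Decays l B) : Decays (k + l) fun n => A n * B n := by
  obtain ⟨C, hC⟩ := hA
  obtain ⟨D, hD⟩ := hB
  refine ⟨C * D, fun n => (norm_mul_le _ _).trans ?_⟩
  have h1 : (0 : ℝ) < (n : ℝ) + 1 := by positivity
  rw [neg_add, Real.rpow_add h1]
  calc ‖A n‖ * ‖B n‖ ≤ _ := mul_le_mul (hC n) (hD n) (norm_nonneg _) ((norm_nonneg _).trans (hC n))
    _ = _ := by ring

theorem Decays.tendsto_zero [SeminormedAddCommGroup E] {A : ℕ → E} {k : ℝ} (hA : Decays k A)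
    (hk : 0 < k) : Filter.Tendsto A Filter.atTop (nhds 0) := by
  obtain ⟨C, hC⟩ := hA
  refine squeeze_zero_norm hC ?_
  have h1 := (tendsto_rpow_neg_atTop hk).comp (Filter.tendsto_atTop_add_const_right _ (1 : ℝ)
    tendsto_natCast_atTop_atTop)
  simpa using h1.const_mul C

theorem decays_single [SeminormedAddCommGroup E] (k : ℝ) (a : E) :
    Decays k (Pi.single 0 a : ℕ → E) := by
  refine ⟨‖a‖, fun n => ?_⟩
  rcases eq_or_ne n 0 with rfl | hn
  · simp
  · rw [Pi.single_eq_of_ne hn, norm_zero]; positivity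

theorem Decays.summable [SeminormedAddCommGroup E] [CompleteSpace E] {A : ℕ → E} {k : ℝ}
    (hA : Decays k A) (hk : 1 < k) : Summable A := by
  obtain ⟨C, hC⟩ := hA
  refine Summable.of_norm_bounded (g := fun n : ℕ => C * ((n : ℝ) + 1) ^ (-k)) ?_ hC
  refine Summable.mul_left C ?_
  have := (summable_nat_add_iff 1).2 (Real.summable_nat_rpow.2 (show -k < -1 by linarith))
  simpa using this

/-- The true size is a power of log n over n. Giving up n^{1/4} absorbs the logarithms, and the
exponent 3/4 reproduces itself: summing yields n^{1/4}, and the next factor divides by n. -/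
theorem decays_chainSeq {R : List ((ℕ → ℝ) × IneqSign)} (hR : ∀ p ∈ R, Decays 1 p.1) :
    Decays (3 / 4) (chainSeq R) := by
  induction R with
  | nil => exact decays_single _ _
  | cons p R ih =>
    have := (ih fun q hq => hR q (by simp [hq])).mul_sum (hR p (by simp)) p.2.below_subset
    norm_num at this
    exact this

end Decay

/-! ### The coefficients b_n and convergence of the series -/

section Coefficients

theorem bCoeff_eq (n : ℕ) : bCoeff n = 4 ^ n / (n.centralBinom : ℝ) := rfl

theorem bCoeff_pos (n : ℕ) : 0 < bCoeff n := by
  rw [bCoeff_eq]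
  have := n.centralBinom_pos
  positivity

@[simp] theorem bCoeff_zero : bCoeff 0 = 1 := by simp [bCoeff]

theorem bCoeff_succ (n : ℕ) : bCoeff (n + 1) = bCoeff n * (2 * n + 2) / (2 * n + 1) := by
  rw [bCoeff_eq, bCoeff_eq]
  have h := congrArg (Nat.cast (R := ℝ)) n.succ_mul_centralBinom_succ
  push_cast at h
  have h1 : ((n + 1).centralBinom : ℝ) ≠ 0 := by exact_mod_cast (n + 1).centralBinom_ne_zero
  have h2 : (n.centralBinom : ℝ) ≠ 0 := by exact_mod_cast n.centralBinom_ne_zero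
  have h3 : (2 * n + 1 : ℝ) ≠ 0 := by positivity
  field_simp
  rw [pow_succ]
  linear_combination -(4 : ℝ) ^ n * 2 * h

/-- The bound 4n + 1 passes through the induction because (4n+5)(2n+1)² - (4n+1)(2n+2)² = 1. -/
theorem bCoeff_sq_le (n : ℕ) : bCoeff n ^ 2 ≤ 4 * n + 1 := by
  induction n with
  | zero => simp
  | succ n ih =>
    have hn : (0 : ℝ) ≤ n := n.cast_nonneg
    rw [bCoeff_succ, div_pow, mul_pow, div_le_iff₀ (by positivity)]
    push_cast
    calc bCoeff n ^ 2 * (2 * n + 2) ^ 2 ≤ (4 * n + 1) * (2 * n + 2 : ℝ) ^ 2 := by gcongr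
      _ ≤ _ := by nlinarith

theorem decays_bCoeff : Decays (-(1 / 2)) bCoeff := by
  refine ⟨2, fun n => ?_⟩
  rw [Real.norm_of_nonneg (bCoeff_pos n).le, neg_neg, ← Real.sqrt_eq_rpow]
  refine le_of_pow_le_pow_left₀ two_ne_zero (by positivity) ?_
  rw [mul_pow, Real.sq_sqrt (by positivity)]
  linarith [bCoeff_sq_le n]

/-- The reciprocal `1 / l(n)`, with value `0` where `l(n) = 0`. -/
noncomputable def LinForm.recip (l : LinForm) (n : ℕ) : ℝ := ((l.eval n : ℤ) : ℝ)⁻¹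

theorem LinForm.recip_even (n : ℕ) : LinForm.even.recip n = (2 * n : ℝ)⁻¹ := by
  simp [recip, eval]

theorem LinForm.recip_oddPlus (n : ℕ) : LinForm.oddPlus.recip n = (2 * n + 1 : ℝ)⁻¹ := by
  simp [recip, eval]

theorem LinForm.recip_oddMinus (n : ℕ) : LinForm.oddMinus.recip n = (2 * n - 1 : ℝ)⁻¹ := by
  simp [recip, eval]

theorem LinForm.abs_recip_le (l : LinForm) (n : ℕ) : |l.recip n| ≤ 2 / ((n : ℝ) + 1) := by
  have hn : (0 : ℝ) ≤ n := n.cast_nonneg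
  rcases Nat.eq_zero_or_pos n with rfl | h
  · cases l <;> norm_num [recip, eval]
  have h1 : (1 : ℝ) ≤ n := by exact_mod_cast h
  cases l
  · rw [recip_even, abs_of_nonneg (by positivity), inv_eq_one_div,
      div_le_div_iff₀ (by positivity) (by positivity)]
    linarith
  · rw [recip_oddPlus, abs_of_nonneg (by positivity), inv_eq_one_div,
      div_le_div_iff₀ (by positivity) (by positivity)]
    linarith
  · rw [recip_oddMinus, abs_of_nonneg (inv_nonneg.2 (by linarith)), inv_eq_one_div,
      div_le_div_iff₀ (by linarith) (by positivity)]
    linarith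

theorem LinForm.abs_recip_le_one (l : LinForm) (n : ℕ) : |l.recip n| ≤ 1 := by
  rw [recip, abs_inv, ← Int.cast_abs]
  rcases eq_or_ne (l.eval n) 0 with h | h
  · simp [h]
  · exact inv_le_one_of_one_le₀ (by exact_mod_cast Int.one_le_abs h)

theorem LinForm.decays_recip_pow (l : LinForm) {k s : ℕ} (hk : k ≤ s) :
    Decays k fun n => l.recip n ^ s := by
  refine ⟨2 ^ k, fun n => ?_⟩
  have h1 : (0 : ℝ) < (n : ℝ) + 1 := by positivity
  rw [Real.rpow_neg h1.le, Real.rpow_natCast, norm_pow, Real.norm_eq_abs, ← div_eq_mul_inv,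
    ← div_pow]
  exact (pow_le_pow_of_le_one (abs_nonneg _) (l.abs_recip_le_one n) hk).trans
    (pow_le_pow_left₀ (abs_nonneg _) (l.abs_recip_le n) k)

/-- The data of the nested sum attached to linear forms, signs and exponents. -/
noncomputable def formChain (R : List (LinForm × IneqSign × ℕ)) : List ((ℕ → ℝ) × IneqSign) :=
  R.map fun p => (fun n => p.1.recip n ^ p.2.2, p.2.1)

theorem decays_formChain {R : List (LinForm × IneqSign × ℕ)} (hR : ∀ p ∈ R, 1 ≤ p.2.2) :
    Decays (3 / 4) (chainSeq (formChain R)) := by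
  refine decays_chainSeq fun q hq => ?_
  obtain ⟨p, hp, rfl⟩ := List.mem_map.1 hq
  exact_mod_cast p.1.decays_recip_pow (hR p hp)

/-- The decay exponent is -1/2 + 2 - 1/4 = 5/4 > 1; this is where the outer exponent 2 is needed. -/
theorem summable_bCoeff_mul {f A : ℕ → ℝ} {s : ℕ → Finset ℕ} (hf : Decays 2 f)
    (hA : Decays (3 / 4) A) (hs : ∀ n, s n ⊆ range (n + 1)) :
    Summable fun n => bCoeff n * (f n * ∑ m ∈ s n, A m) :=
  (decays_bCoeff.mul (hA.mul_sum hf hs)).summable (by norm_num)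

theorem hasAperySum_tsum {d : ℕ} (hd : 0 < d) (s : Fin d → ℕ) (hs : ∀ j, 1 ≤ s j)
    (hs1 : 2 ≤ s ⟨0, hd⟩) (l : Fin d → LinForm) (r : Fin d → IneqSign) :
    HasAperySum hd s l r
      (∑' n, bCoeff n * chainSeq (formChain (List.ofFn fun j => (l j, r j, s j))) n) := by
  have h1 := hasSum_chain d (fun j n => (l j).recip n ^ s j) r bCoeff ?_
  · rw [HasAperySum]
    have h2 : formChain (List.ofFn fun j => (l j, r j, s j)) =
        List.ofFn fun j => (fun n => (l j).recip n ^ s j, r j) := by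
      simp [formChain, List.map_ofFn, Function.comp_def]
    rw [h2]
    have h3 : (fun n : summationRange r => aperyTerm hd s l n) =
        (fun n : Fin d → ℕ => bCoeff (headIndex n) * ∏ j, (l j).recip (n j) ^ s j) ∘
          ((↑) : summationRange r → Fin d → ℕ) := by
      funext n
      simp only [aperyTerm, headIndex, dif_pos hd, LinForm.recip, Function.comp_apply,
        div_eq_mul_inv, ← Finset.prod_inv_distrib, inv_pow]
    rw [h3, hasSum_subtype_iff_indicator]
    exact h1
  · obtain ⟨k, rfl⟩ : ∃ k, d = k + 1 := ⟨d - 1, by omega⟩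
    simp only [List.ofFn_succ, chainSeq, abs_of_pos (bCoeff_pos _)]
    refine summable_bCoeff_mul ?_ (decays_chainSeq ?_) (r 0).below_subset
    · obtain ⟨C, hC⟩ := (l 0).decays_recip_pow hs1
      exact ⟨C, fun n => by simpa using hC n⟩
    · intro p hp
      obtain ⟨j, rfl⟩ := (List.mem_ofFn' _ _).1 hp
      obtain ⟨C, hC⟩ := (l j.succ).decays_recip_pow (hs j.succ)
      exact ⟨C, fun n => by simpa using hC n⟩

end Coefficients

/-! ### Polylogarithm coefficients and integration operators on them -/

section ColoredValues

/-- The coefficients `∑_{n = n₁ > n₂ > ⋯ > n_d > 0} ∏_j z_j ^ {n_j} / n_j ^ {s_j}` of a multiple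
polylogarithm, as a sequence in the outermost index. -/
noncomputable def polySeq : List (ℕ × ℂ) → ℕ → ℂ
  | [] => Pi.single 0 1
  | p :: W => fun n => p.2 ^ n / (n : ℂ) ^ p.1 * ∑ m ∈ range n, polySeq W m

theorem mem_filter_strictAnti_succ {d : ℕ} (M : ℕ) (n : Fin (d + 1) → ℕ) :
    ((∀ j, n j ∈ Icc 1 M) ∧ StrictAnti n) ↔
      n 0 ∈ Icc 1 M ∧ (∀ j, Fin.tail n j ∈ Icc 1 (n 0 - 1)) ∧ StrictAnti (Fin.tail n) := by
  simp only [mem_Icc, Fin.tail]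
  constructor
  · rintro ⟨h1, h2⟩
    refine ⟨h1 0, fun j => ⟨(h1 _).1, ?_⟩, fun i j hij => h2 (Fin.succ_lt_succ_iff.2 hij)⟩
    have := h2 (Fin.succ_pos j)
    omega
  · rintro ⟨h1, h2, h3⟩
    refine ⟨fun j => ?_, fun i j hij => ?_⟩
    · cases j using Fin.cases with
      | zero => exact h1
      | succ j => have := h2 j; omega
    · cases j using Fin.cases with
      | zero => exact absurd hij (Fin.not_lt_zero i)
      | succ j =>
        cases i using Fin.cases with
        | zero => have := h2 j; omega
        | succ i => exact h3 (Fin.succ_lt_succ_iff.1 hij)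

theorem polylogPartialSum_succ {d : ℕ} (s : Fin (d + 1) → ℕ) (z : Fin (d + 1) → ℂ) (M : ℕ) :
    polylogPartialSum s z M = ∑ n ∈ Icc 1 M, z 0 ^ n / (n : ℂ) ^ s 0 *
      polylogPartialSum (fun j => s j.succ) (fun j => z j.succ) (n - 1) := by
  classical
  simp only [polylogPartialSum, mul_sum]
  rw [sum_sigma']
  refine sum_bij' (fun n _ => ⟨n 0, Fin.tail n⟩) (fun p _ => Fin.cons p.1 p.2) ?_ ?_ ?_ ?_ ?_
  · intro n hn
    rw [mem_filter, Fintype.mem_piFinset] at hn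
    rw [mem_sigma, mem_filter, Fintype.mem_piFinset]
    exact (mem_filter_strictAnti_succ M n).1 hn
  · rintro ⟨k, n⟩ hn
    rw [mem_sigma, mem_filter, Fintype.mem_piFinset] at hn
    rw [mem_filter, Fintype.mem_piFinset]
    refine (mem_filter_strictAnti_succ M _).2 ?_
    simpa using hn
  · intro n _
    exact Fin.cons_self_tail n
  · rintro ⟨k, n⟩ _
    simp
  · intro n _
    rw [Fin.prod_univ_succ]
    rfl

theorem polylogPartialSum_eq_sum : ∀ {d : ℕ} (s : Fin d → ℕ) (z : Fin d → ℂ) (M : ℕ),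
    polylogPartialSum s z M = ∑ n ∈ range (M + 1), polySeq (List.ofFn fun j => (s j, z j)) n := by
  intro d
  induction d with
  | zero =>
    intro s z M
    classical
    rw [sum_range_succ']
    simp [polylogPartialSum, polySeq, Subsingleton.strictAnti]
  | succ d ih =>
    intro s z M
    rw [polylogPartialSum_succ, sum_range_succ', List.ofFn_succ]
    simp only [polySeq, range_zero, sum_empty, mul_zero, add_zero]
    rw [← Ico_add_one_right_eq_Icc, sum_Ico_eq_sum_range]
    refine sum_congr rfl fun n _ => ?_
    rw [Nat.add_sub_cancel_left, ih, add_comm 1 n]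

theorem decays_pow_div_pow {z : ℂ} (hz : ‖z‖ = 1) {k s : ℕ} (hk : k ≤ s) :
    Decays k fun n : ℕ => z ^ n / (n : ℂ) ^ s := by
  obtain ⟨C, hC⟩ := LinForm.even.decays_recip_pow hk
  refine ⟨2 ^ s * C, fun n => ?_⟩
  rw [mul_assoc]
  refine le_trans (le_of_eq ?_) (mul_le_mul_of_nonneg_left (hC n) (by positivity))
  simp only [LinForm.recip_even]
  rw [norm_div, norm_pow, norm_pow, hz, norm_pow, norm_inv, norm_mul]
  simp [mul_pow]
  field_simp

theorem norm_eq_one_of_pow_four {z : ℂ} (hz : z ^ 4 = 1) : ‖z‖ = 1 :=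
  Complex.norm_eq_one_of_pow_eq_one hz four_ne_zero

theorem decays_polySeq {W : List (ℕ × ℂ)} (hW : ∀ p ∈ W, 1 ≤ p.1 ∧ p.2 ^ 4 = 1) :
    Decays (3 / 4) (polySeq W) := by
  induction W with
  | nil => exact decays_single _ _
  | cons p W ih =>
    have hp := hW p (by simp)
    have := (ih fun q hq => hW q (by simp [hq])).mul_sum
      (decays_pow_div_pow (norm_eq_one_of_pow_four hp.2) hp.1)
      (fun n => range_subset_range.2 n.le_succ)
    norm_num at this
    exact this

/-- Dirichlet's test by summation by parts; it covers the conditionally convergent case s₁ = 1, z₁ ≠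
1. -/
theorem exists_tendsto_sum_pow_mul {z : ℂ} (hz : ‖z‖ = 1) (hz1 : z ≠ 1) {a : ℕ → ℂ}
    (ha0 : a 0 = 0) (ha : Filter.Tendsto a Filter.atTop (nhds 0))
    (hs : Summable fun n => ‖a (n + 1) - a n‖) :
    ∃ v, Filter.Tendsto (fun N => ∑ n ∈ range N, z ^ n * a n) Filter.atTop (nhds v) := by
  have key : ∀ N, ∑ n ∈ range N, z ^ n * a n =
      (1 - z)⁻¹ * (∑ n ∈ range N, z ^ (n + 1) * (a (n + 1) - a n) - z ^ N * a N) := by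
    intro N
    rw [eq_inv_mul_iff_mul_eq₀ (sub_ne_zero.2 hz1.symm)]
    induction N with
    | zero => simp [ha0]
    | succ N ih => rw [sum_range_succ, sum_range_succ, mul_add, ih]; ring
  have h1 : Summable fun n => z ^ (n + 1) * (a (n + 1) - a n) :=
    Summable.of_norm (by simpa [hz] using hs)
  have h2 : Filter.Tendsto (fun N => z ^ N * a N) Filter.atTop (nhds 0) := by
    rw [tendsto_zero_iff_norm_tendsto_zero] at ha ⊢
    simpa [hz] using ha
  simp only [key]
  exact ⟨_, (h1.hasSum.tendsto_sum_nat.sub h2).const_mul _⟩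

theorem exists_tendsto_sum_polySeq {W : List (ℕ × ℂ)} (hW : ∀ p ∈ W, 1 ≤ p.1 ∧ p.2 ^ 4 = 1)
    (h1 : ∀ p ∈ W.head?, p ≠ (1, 1)) :
    ∃ v, Filter.Tendsto (fun N => ∑ n ∈ range N, polySeq W n) Filter.atTop (nhds v) := by
  rcases W with _ | ⟨⟨s, z⟩, W⟩
  · exact ⟨_, (hasSum_pi_single 0 1).tendsto_sum_nat⟩
  have hp := hW (s, z) (by simp)
  have hz := norm_eq_one_of_pow_four hp.2
  have hdec := decays_polySeq (W := W) fun q hq => hW q (by simp [hq])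
  have hsub : ∀ n, range n ⊆ range (n + 1) := fun n => range_subset_range.2 n.le_succ
  rcases hp.1.eq_or_lt with hs | hs
  · obtain rfl : 1 = s := hs
    have hz1 : z ≠ 1 := fun h => h1 (1, z) (by simp) (by rw [h])
    have hv := exists_tendsto_sum_pow_mul hz hz1
      (a := fun n => (n : ℂ)⁻¹ * ∑ m ∈ range n, polySeq W m) (by simp) ?_ ?_
    · obtain ⟨v, hv⟩ := hv
      refine ⟨v, hv.congr fun N => sum_congr rfl fun n _ => ?_⟩
      simp [polySeq, div_eq_mul_inv, mul_assoc]
    · have h3 : Decays 1 fun n : ℕ => (n : ℂ)⁻¹ := by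
        simpa using decays_pow_div_pow (z := 1) (by simp) (le_refl 1)
      exact (hdec.mul_sum h3 hsub).tendsto_zero (by norm_num)
    · have h4 : Decays 2 fun n : ℕ => ((n : ℂ) + 1)⁻¹ - (n : ℂ)⁻¹ := by
        refine ⟨2, fun n => ?_⟩
        rw [show (-2 : ℝ) = -((2 : ℕ) : ℝ) by norm_num, Real.rpow_neg (by positivity),
          Real.rpow_natCast]
        rcases Nat.eq_zero_or_pos n with rfl | hn
        · simp
        have h5 : (1 : ℝ) ≤ n := by exact_mod_cast hn
        have h6 : ((n : ℂ) + 1)⁻¹ - (n : ℂ)⁻¹ = ((-(((n : ℝ) + 1) * n)⁻¹ : ℝ) : ℂ) := by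
          push_cast
          have : (n : ℂ) ≠ 0 := by exact_mod_cast hn.ne'
          have : (n : ℂ) + 1 ≠ 0 := by exact_mod_cast n.succ_ne_zero
          field_simp
          ring
        refine le_of_eq_of_le (congrArg norm h6) ?_
        rw [Complex.norm_real, norm_neg, Real.norm_of_nonneg (by positivity), inv_eq_one_div,
          ← div_eq_mul_inv, div_le_div_iff₀ (by positivity) (by positivity)]
        nlinarith
      have h7 : Decays 1 fun n : ℕ => ((n : ℂ) + 1)⁻¹ := by
        refine ⟨1, fun n => ?_⟩
        rw [Real.rpow_neg_one, norm_inv, one_mul, ← Nat.cast_succ, Complex.norm_natCast]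
        simp
      -- The increment splits by the product rule into parts of order 1 + 3/4 and 2 - 1/4, both
      -- equal to 7/4.
      have h8 := ((h7.mul hdec).mono (k' := 7 / 4) (by norm_num) fun n => norm_nonneg _).add
        ((hdec.mul_sum h4 hsub).mono (k' := 7 / 4) (by norm_num) fun n => norm_nonneg _)
      refine ((h8.summable (by norm_num)).norm).congr fun n => ?_
      simp only [Pi.add_apply, sum_range_succ, Nat.cast_succ]
      congr 1
      ring
  · have := hdec.mul_sum (decays_pow_div_pow hz hs) hsub
    exact ⟨_, (this.summable (by norm_num)).hasSum.tendsto_sum_nat⟩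

/-- The compositions with fourth roots of unity of weight `w`. -/
def ColoredIndex (w : ℕ) : Set (List (ℕ × ℂ)) :=
  {W | (∀ p ∈ W, 1 ≤ p.1 ∧ p.2 ^ 4 = 1) ∧ (W.map Prod.fst).sum = w}

theorem exists_isCMZV_tendsto {w : ℕ} {W : List (ℕ × ℂ)} (hW : W ∈ ColoredIndex w)
    (h1 : ∀ p ∈ W.head?, p ≠ (1, 1)) : ∃ v, IsCMZV 4 w v ∧
      Filter.Tendsto (fun N => ∑ n ∈ range N, polySeq W n) Filter.atTop (nhds v) := by
  obtain ⟨v, hv⟩ := exists_tendsto_sum_polySeq hW.1 h1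
  refine ⟨v, ⟨W.length, fun j => (W.get j).1, fun j => (W.get j).2,
    fun j => (hW.1 _ (W.get_mem j)).1, fun j => (hW.1 _ (W.get_mem j)).2, ?_, ?_, ?_⟩, hv⟩
  · rw [← hW.2, ← List.sum_ofFn]
    congr 1
    conv_rhs => rw [← List.ofFn_get W, List.map_ofFn]
    rfl
  · rintro h ⟨h2, h3⟩
    rcases W with _ | ⟨p, W⟩
    · simp at h
    · exact h1 p (by simp) (Prod.ext h2 h3)
  · have h2 : (List.ofFn fun j => ((W.get j).1, (W.get j).2)) = W := List.ofFn_get W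
    refine ((Filter.tendsto_add_atTop_iff_nat 1).2 hv).congr fun M => ?_
    rw [polylogPartialSum_eq_sum, h2]

/-- The span of the coefficient sequences of weight `w`. -/
noncomputable def polySpan (w : ℕ) : Submodule ℚ (ℕ → ℂ) :=
  Submodule.span ℚ (polySeq '' ColoredIndex w)

/-- The span of the coefficient sequences of weight `w` of the series that converge at `1`. -/
noncomputable def convSpan (w : ℕ) : Submodule ℚ (ℕ → ℂ) :=
  Submodule.span ℚ (polySeq '' {W | W ∈ ColoredIndex w ∧ ∀ p ∈ W.head?, p ≠ (1, 1)})

theorem convSpan_le_polySpan (w : ℕ) : convSpan w ≤ polySpan w :=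
  Submodule.span_mono (Set.image_mono fun _ h => h.1)

theorem exists_mem_CMZV_tendsto {w : ℕ} {c : ℕ → ℂ} (hc : c ∈ convSpan w) :
    ∃ v ∈ CMZV 4 w, Filter.Tendsto (fun N => ∑ n ∈ range N, c n) Filter.atTop (nhds v) := by
  induction hc using Submodule.span_induction with
  | mem c hc =>
    obtain ⟨W, ⟨hW, h1⟩, rfl⟩ := hc
    obtain ⟨v, hv, ht⟩ := exists_isCMZV_tendsto hW h1
    exact ⟨v, Submodule.subset_span hv, ht⟩
  | zero => exact ⟨0, zero_mem _, by simp⟩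
  | add c c' _ _ h h' =>
    obtain ⟨v, hv, ht⟩ := h
    obtain ⟨v', hv', ht'⟩ := h'
    exact ⟨v + v', add_mem hv hv', by simpa [sum_add_distrib] using ht.add ht'⟩
  | smul q c _ h =>
    obtain ⟨v, hv, ht⟩ := h
    exact ⟨q • v, Submodule.smul_mem _ _ hv, by simpa [← smul_sum] using ht.const_smul q⟩

theorem bounded_of_mem_polySpan {w : ℕ} {c : ℕ → ℂ} (hc : c ∈ polySpan w) :
    ∃ C, ∀ n, ‖c n‖ ≤ C := by
  induction hc using Submodule.span_induction with
  | mem c hc =>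
    obtain ⟨W, hW, rfl⟩ := hc
    obtain ⟨C, hC⟩ := (decays_polySeq hW.1).mono (k' := 0) (by norm_num) fun n => norm_nonneg _
    exact ⟨C, fun n => by simpa using hC n⟩
  | zero => exact ⟨0, by simp⟩
  | add c c' _ _ h h' =>
    obtain ⟨C, hC⟩ := h
    obtain ⟨C', hC'⟩ := h'
    exact ⟨C + C', fun n => (norm_add_le _ _).trans (add_le_add (hC n) (hC' n))⟩
  | smul q c _ h =>
    obtain ⟨C, hC⟩ := h
    refine ⟨‖(q : ℂ)‖ * C, fun n => ?_⟩
    rw [Pi.smul_apply, Rat.smul_def, norm_mul]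
    exact mul_le_mul_of_nonneg_left (hC n) (norm_nonneg _)

/-- Integrating a series against dx/x requires a zero constant term; positive weight guarantees it.
-/
theorem apply_zero_of_mem_polySpan {w : ℕ} {c : ℕ → ℂ} (hc : c ∈ polySpan (w + 1)) : c 0 = 0 := by
  induction hc using Submodule.span_induction with
  | mem c hc =>
    obtain ⟨W, hW, rfl⟩ := hc
    rcases W with _ | ⟨p, W⟩
    · exact absurd hW.2 (by simp)
    · simp [polySeq]
  | zero => rfl
  | add c c' _ _ h h' => simp [h, h']
  | smul q c _ h => simp [h]

/-- On coefficients, the operator `g ↦ ∫₀ g(x) dx / x`. -/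
noncomputable def divOp : (ℕ → ℂ) →ₗ[ℚ] (ℕ → ℂ) where
  toFun c n := c n / n
  map_add' c c' := by ext n; simp [add_div]
  map_smul' q c := by ext n; simp [Rat.smul_def, mul_div_assoc]

/-- On coefficients, the operator `g ↦ ∫₀ g(x) dx / (a - x)`. -/
noncomputable def intOp (a : ℂ) : (ℕ → ℂ) →ₗ[ℚ] (ℕ → ℂ) where
  toFun c n := a⁻¹ ^ n / n * ∑ m ∈ range n, a ^ m * c m
  map_add' c c' := by ext n; simp [mul_add, sum_add_distrib]
  map_smul' q c := by
    ext n
    simp only [Pi.smul_apply, Rat.smul_def, RingHom.id_apply, mul_left_comm _ (q : ℂ), ← mul_sum]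

/-- Dividing by n raises the first exponent to at least 2, so the result converges at 1. The empty
index is sent to 0, since its only nonzero coefficient sits at n = 0, where division by zero returns
0. -/
theorem divOp_mem {w : ℕ} {c : ℕ → ℂ} (hc : c ∈ polySpan w) : divOp c ∈ convSpan (w + 1) := by
  suffices h : polySpan w ≤ (convSpan (w + 1)).comap divOp from h hc
  refine Submodule.span_le.2 ?_
  rintro _ ⟨W, hW, rfl⟩
  rcases W with _ | ⟨p, W⟩
  · have : divOp (polySeq []) = 0 := by
      ext n
      rcases eq_or_ne n 0 with rfl | hn <;> simp [divOp, polySeq, *]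
    simp [this]
  · have h1 := hW.1 p (by simp)
    have h2 : divOp (polySeq (p :: W)) = polySeq ((p.1 + 1, p.2) :: W) := by
      ext n
      simp only [divOp, polySeq, LinearMap.coe_mk, AddHom.coe_mk, pow_succ, div_mul_eq_mul_div,
        div_div]
    refine Submodule.subset_span ⟨_, ⟨⟨?_, ?_⟩, ?_⟩, h2.symm⟩
    · simp only [List.mem_cons, forall_eq_or_imp]
      exact ⟨⟨by simp, h1.2⟩, fun q hq => hW.1 q (by simp [hq])⟩
    · have := hW.2
      simp only [List.map_cons, List.sum_cons] at this ⊢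
      omega
    · simp only [List.head?_cons, Option.mem_def, Option.some.injEq, forall_eq']
      intro h
      have := congrArg Prod.fst h
      simp at this
      omega

/-- The factor a^m inside the sum is absorbed by the former leading root of unity, and a new letter
(1, a⁻¹) is put in front. It violates convergence only for a = 1. -/
theorem intOp_polySeq {a : ℂ} (ha : a ^ 4 = 1) {w : ℕ} {W : List (ℕ × ℂ)}
    (hW : W ∈ ColoredIndex w) : ∃ W', (1, a⁻¹) :: W' ∈ ColoredIndex (w + 1) ∧
      intOp a (polySeq W) = polySeq ((1, a⁻¹) :: W') := by
  have ha' : a⁻¹ ^ 4 = 1 := by rw [inv_pow, ha, inv_one]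
  rcases W with _ | ⟨p, W⟩
  · refine ⟨[], ⟨by simp [ha'], by simp [← hW.2]⟩, ?_⟩
    ext n
    simp only [intOp, polySeq, LinearMap.coe_mk, AddHom.coe_mk, pow_one]
    congr 1
    refine sum_congr rfl fun m _ => ?_
    rcases eq_or_ne m 0 with rfl | hm <;> simp [*]
  · have h1 := hW.1 p (by simp)
    refine ⟨(p.1, a * p.2) :: W, ⟨?_, ?_⟩, ?_⟩
    · simp only [List.mem_cons, forall_eq_or_imp]
      exact ⟨⟨le_rfl, ha'⟩, ⟨h1.1, by rw [mul_pow, ha, h1.2, one_mul]⟩,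
        fun q hq => hW.1 q (by simp [hq])⟩
    · have := hW.2
      simp only [List.map_cons, List.sum_cons] at this ⊢
      omega
    · ext n
      simp only [intOp, polySeq, LinearMap.coe_mk, AddHom.coe_mk, pow_one]
      congr 1
      refine sum_congr rfl fun m _ => ?_
      rw [mul_pow]
      ring

theorem intOp_mem {a : ℂ} (ha : a ^ 4 = 1) {w : ℕ} {c : ℕ → ℂ} (hc : c ∈ polySpan w) :
    intOp a c ∈ polySpan (w + 1) := by
  suffices h : polySpan w ≤ (polySpan (w + 1)).comap (intOp a) from h hc
  refine Submodule.span_le.2 ?_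
  rintro _ ⟨W, hW, rfl⟩
  obtain ⟨W', h1, h2⟩ := intOp_polySeq ha hW
  exact Submodule.subset_span ⟨_, h1, h2.symm⟩

theorem intOp_mem_convSpan {a : ℂ} (ha : a ^ 4 = 1) (ha1 : a ≠ 1) {w : ℕ} {c : ℕ → ℂ}
    (hc : c ∈ polySpan w) : intOp a c ∈ convSpan (w + 1) := by
  suffices h : polySpan w ≤ (convSpan (w + 1)).comap (intOp a) from h hc
  refine Submodule.span_le.2 ?_
  rintro _ ⟨W, hW, rfl⟩
  obtain ⟨W', h1, h2⟩ := intOp_polySeq ha hW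
  refine Submodule.subset_span ⟨_, ⟨h1, ?_⟩, h2.symm⟩
  simpa using ha1

end ColoredValues

/-! ### Power series and their primitives -/

section PowerSeries

/-- The norms of a sequence grow at most polynomially. -/
def PolyBounded (a : ℕ → ℂ) : Prop := ∃ (C : ℝ) (p : ℕ), ∀ n : ℕ, ‖a n‖ ≤ C * ((n : ℝ) + 1) ^ p

/-- The series `∑ a_n x ^ {k_n}`. -/
noncomputable def powSum (a : ℕ → ℂ) (k : ℕ → ℕ) (x : ℝ) : ℂ := ∑' n, a n * (x : ℂ) ^ k n

theorem summable_add_one_pow_mul_geometric (p : ℕ) {r : ℝ} (hr0 : 0 ≤ r) (hr : r < 1) :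
    Summable fun n : ℕ => ((n : ℝ) + 1) ^ p * r ^ n := by
  rcases hr0.eq_or_lt with rfl | h0
  · exact summable_of_ne_finset_zero (s := {0}) fun n hn => by
      rw [zero_pow (by simpa using hn), mul_zero]
  have h1 := (summable_nat_add_iff 1).2 (summable_pow_mul_geometric_of_norm_lt_one (R := ℝ) p
    (r := r) (by rwa [Real.norm_of_nonneg hr0]))
  refine (h1.mul_left r⁻¹).congr fun n => ?_
  push_cast
  rw [pow_succ]
  field_simp

theorem hasSum_powSum {a : ℕ → ℂ} (ha : PolyBounded a) {k : ℕ → ℕ} (hk : ∀ n, n ≤ k n) {x : ℝ}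
    (hx : |x| < 1) : HasSum (fun n => a n * (x : ℂ) ^ k n) (powSum a k x) := by
  refine Summable.hasSum ?_
  obtain ⟨C, p, hC⟩ := ha
  refine Summable.of_norm_bounded (((summable_add_one_pow_mul_geometric p (abs_nonneg x)
    hx)).mul_left C) fun n => ?_
  rw [norm_mul, norm_pow, Complex.norm_real, Real.norm_eq_abs, ← mul_assoc]
  exact mul_le_mul (hC n) (pow_le_pow_of_le_one (abs_nonneg x) hx.le (hk n)) (by positivity)
    ((norm_nonneg _).trans (hC n))

theorem hasDerivAt_powSum {a : ℕ → ℂ} (ha : PolyBounded a) {k : ℕ → ℕ} (hk : ∀ n, n ≤ k n)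
    (hk' : ∀ n, k n ≤ 2 * n + 1) {x : ℝ} (hx : |x| < 1) :
    Summable (fun n => a n * (k n * (x : ℂ) ^ (k n - 1))) ∧
    HasDerivAt (powSum a k) (∑' n, a n * (k n * (x : ℂ) ^ (k n - 1))) x := by
  obtain ⟨C, p, hC⟩ := ha
  obtain ⟨r, hxr, hr1⟩ := exists_between hx
  have hr0 : 0 < r := (abs_nonneg x).trans_lt hxr
  have hu : Summable fun n : ℕ => 2 * C * r⁻¹ * (((n : ℝ) + 1) ^ (p + 1) * r ^ n) :=
    (summable_add_one_pow_mul_geometric (p + 1) hr0.le hr1).mul_left _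
  have hbound : ∀ (n : ℕ), ∀ y ∈ Metric.ball (0 : ℝ) r,
      ‖a n * (k n * (y : ℂ) ^ (k n - 1))‖ ≤ 2 * C * r⁻¹ * (((n : ℝ) + 1) ^ (p + 1) * r ^ n) := by
    intro n y hy
    rw [Metric.mem_ball, dist_zero_right, Real.norm_eq_abs] at hy
    rw [norm_mul, norm_mul, norm_pow, Complex.norm_real, Real.norm_eq_abs, Complex.norm_natCast]
    have h2 : (k n : ℝ) * |y| ^ (k n - 1) ≤ 2 * (n + 1) * (r⁻¹ * r ^ n) := by
      rcases Nat.eq_zero_or_pos (k n) with h0 | h0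
      · rw [h0]; simp; positivity
      have h3 : |y| ^ (k n - 1) ≤ r⁻¹ * r ^ n :=
        calc |y| ^ (k n - 1) ≤ r ^ (k n - 1) := by gcongr
          _ = r⁻¹ * r ^ (k n) := by
            rw [eq_inv_mul_iff_mul_eq₀ hr0.ne', ← pow_succ', Nat.sub_add_cancel h0]
          _ ≤ r⁻¹ * r ^ n := by
            have := pow_le_pow_of_le_one hr0.le hr1.le (hk n)
            gcongr
      have h4 : (k n : ℝ) ≤ 2 * (n + 1) := by
        have : (k n : ℝ) ≤ 2 * n + 1 := by exact_mod_cast hk' n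
        linarith
      gcongr
    calc ‖a n‖ * ((k n : ℝ) * |y| ^ (k n - 1))
        ≤ (C * ((n : ℝ) + 1) ^ p) * (2 * (n + 1) * (r⁻¹ * r ^ n)) :=
          mul_le_mul (hC n) h2 (by positivity) ((norm_nonneg _).trans (hC n))
      _ = _ := by ring
  have hmem : x ∈ Metric.ball (0 : ℝ) r := by simpa using hxr
  refine ⟨Summable.of_norm_bounded hu fun n => hbound n x hmem, ?_⟩
  refine hasDerivAt_tsum_of_isPreconnected (g := fun n (y : ℝ) => a n * (y : ℂ) ^ k n)
    (g' := fun n (y : ℝ) => a n * (k n * (y : ℂ) ^ (k n - 1))) hu Metric.isOpen_ball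
    (convex_ball _ _).isPreconnected ?_ hbound hmem
    (hasSum_powSum ⟨C, p, hC⟩ hk hx).summable hmem
  intro n y _
  exact (HasDerivAt.comp_ofReal (hasDerivAt_pow (k n) (y : ℂ))).const_mul (a n)

theorem HasSum.hasDerivAt_powSum {a : ℕ → ℂ} (ha : PolyBounded a) {k : ℕ → ℕ} (hk : ∀ n, n ≤ k n)
    (hk' : ∀ n, k n ≤ 2 * n + 1) {x : ℝ} (hx : |x| < 1) {D : ℂ}
    (hD : HasSum (fun n => a n * (k n * (x : ℂ) ^ (k n - 1))) D) :
    HasDerivAt (powSum a k) D x :=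
  hD.tsum_eq ▸ (_root_.hasDerivAt_powSum ha hk hk' hx).2

theorem powSum_zero {a : ℕ → ℂ} {k : ℕ → ℕ} (h : ∀ n, a n = 0 ∨ k n ≠ 0) : powSum a k 0 = 0 := by
  rw [powSum]
  convert tsum_zero with n
  rcases h n with h | h <;> simp [h]

theorem PolyBounded.add {a b : ℕ → ℂ} (ha : PolyBounded a) (hb : PolyBounded b) :
    PolyBounded (a + b) := by
  obtain ⟨C, p, hC⟩ := ha
  obtain ⟨D, q, hD⟩ := hb
  have hC0 : 0 ≤ C := by simpa using (norm_nonneg _).trans (hC 0)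
  have hD0 : 0 ≤ D := by simpa using (norm_nonneg _).trans (hD 0)
  refine ⟨C + D, p + q, fun n => (norm_add_le _ _).trans ?_⟩
  have h1 : (1 : ℝ) ≤ (n : ℝ) + 1 := by linarith [(n.cast_nonneg : (0 : ℝ) ≤ n)]
  have h2 := pow_le_pow_right₀ h1 (Nat.le_add_right p q)
  have h3 := pow_le_pow_right₀ h1 (Nat.le_add_left q p)
  calc ‖a n‖ + ‖b n‖ ≤ C * ((n : ℝ) + 1) ^ p + D * ((n : ℝ) + 1) ^ q := add_le_add (hC n) (hD n)
    _ ≤ C * ((n : ℝ) + 1) ^ (p + q) + D * ((n : ℝ) + 1) ^ (p + q) := by gcongr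
    _ = _ := by ring

theorem PolyBounded.neg {a : ℕ → ℂ} (ha : PolyBounded a) : PolyBounded (-a) := by
  obtain ⟨C, p, hC⟩ := ha
  exact ⟨C, p, fun n => by simpa using hC n⟩

theorem polyBounded_of_mem_polySpan {w : ℕ} {c : ℕ → ℂ} (hc : c ∈ polySpan w) : PolyBounded c := by
  obtain ⟨C, hC⟩ := bounded_of_mem_polySpan hc
  exact ⟨C, 0, fun n => by simpa using hC n⟩

/-- The power series with coefficients `e` is a primitive on `(0, 1)`, vanishing at `0`, of `φ` times
the power series with coefficients `c`. -/
structure IsPrimitive (c e : ℕ → ℂ) (φ : ℝ → ℂ) : Prop where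
  polyBounded : PolyBounded e
  apply_zero : e 0 = 0
  hasSum : ∀ u ∈ Set.Ioo (0 : ℝ) 1,
    HasSum (fun n => e n * (n * (u : ℂ) ^ (n - 1))) (φ u * powSum c id u)

theorem IsPrimitive.add {c e e' : ℕ → ℂ} {φ φ' : ℝ → ℂ} (h : IsPrimitive c e φ)
    (h' : IsPrimitive c e' φ') : IsPrimitive c (e + e') (φ + φ') where
  polyBounded := h.polyBounded.add h'.polyBounded
  apply_zero := by simp [h.apply_zero, h'.apply_zero]
  hasSum u hu := by simpa [add_mul] using (h.hasSum u hu).add (h'.hasSum u hu)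

theorem IsPrimitive.neg {c e : ℕ → ℂ} {φ : ℝ → ℂ} (h : IsPrimitive c e φ) :
    IsPrimitive c (-e) (-φ) where
  polyBounded := h.polyBounded.neg
  apply_zero := by simp [h.apply_zero]
  hasSum u hu := by simpa using (h.hasSum u hu).neg

theorem isPrimitive_divOp {w : ℕ} {c : ℕ → ℂ} (hc : c ∈ polySpan w) (h0 : c 0 = 0) :
    IsPrimitive c (divOp c) fun u => (u : ℂ)⁻¹ where
  polyBounded := polyBounded_of_mem_polySpan (convSpan_le_polySpan _ (divOp_mem hc))
  apply_zero := by simp [divOp]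
  hasSum u hu := by
    have hu0 : (u : ℂ) ≠ 0 := by exact_mod_cast hu.1.ne'
    have h1 := (hasSum_powSum (polyBounded_of_mem_polySpan hc) (k := id) (fun n => le_rfl)
      (abs_lt.2 ⟨by linarith [hu.1], hu.2⟩)).mul_left (u : ℂ)⁻¹
    refine h1.congr_fun fun n => ?_
    rcases n with _ | n
    · simp [h0]
    · have : ((n + 1 : ℕ) : ℂ) ≠ 0 := by exact_mod_cast n.succ_ne_zero
      simp only [divOp, LinearMap.coe_mk, AddHom.coe_mk, id, Nat.add_sub_cancel, pow_succ]
      field_simp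

theorem isPrimitive_intOp {a : ℂ} (ha : a ^ 4 = 1) {w : ℕ} {c : ℕ → ℂ} (hc : c ∈ polySpan w)
    (hau : ∀ u ∈ Set.Ioo (0 : ℝ) 1, a - u ≠ 0) :
    IsPrimitive c (intOp a c) fun u => (a - u)⁻¹ where
  polyBounded := polyBounded_of_mem_polySpan (intOp_mem ha hc)
  apply_zero := by simp [intOp]
  hasSum u hu := by
    have ha0 : a ≠ 0 := by rintro rfl; simp at ha
    have hu1 : |u| < 1 := abs_lt.2 ⟨by linarith [hu.1], hu.2⟩
    have h1 := (hasDerivAt_powSum (polyBounded_of_mem_polySpan (intOp_mem ha hc)) (k := id)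
      (fun n => le_rfl) (fun n => by simp only [id]; omega) hu1).1
    obtain ⟨D, hD⟩ := h1
    simp only [id] at hD
    -- Multiplying the differentiated series by a - u telescopes the inner partial sums back to the
    -- single coefficient c_n.
    suffices h : (a - u) * D = powSum c id u by
      rwa [← h, inv_mul_cancel_left₀ (hau u hu)]
    have h2 := ((hasSum_nat_add_iff' 1).2 hD).mul_left a
    have h3 := hD.mul_left (u : ℂ)
    have h4 := h2.sub h3
    have h5 := hasSum_powSum (polyBounded_of_mem_polySpan hc) (k := id) (fun n => le_rfl) hu1
    have h6 : ∀ n : ℕ, (n : ℂ) * intOp a c n = a⁻¹ ^ n * ∑ m ∈ range n, a ^ m * c m := by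
      intro n
      rcases n with _ | n
      · simp
      · have hn : ((n + 1 : ℕ) : ℂ) ≠ 0 := by exact_mod_cast n.succ_ne_zero
        simp only [intOp, LinearMap.coe_mk, AddHom.coe_mk]
        field_simp
    have h7 : (u : ℂ) ≠ 0 := by exact_mod_cast hu.1.ne'
    have h8 := h5.unique (h4.congr_fun fun n => ?_)
    · rw [h8]
      simp
      ring
    · have h9 : (u : ℂ) * (intOp a c n * (n * (u : ℂ) ^ (n - 1))) =
          a⁻¹ ^ n * (∑ m ∈ range n, a ^ m * c m) * u ^ n := by
        rw [← h6]
        rcases n with _ | n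
        · simp
        · rw [Nat.add_sub_cancel, pow_succ (u : ℂ)]; ring
      have h10 : a * a⁻¹ ^ (n + 1) = a⁻¹ ^ n := by
        rw [pow_succ', mul_inv_cancel_left₀ ha0]
      have h11 : a⁻¹ ^ n * a ^ n = 1 := by rw [← mul_pow, inv_mul_cancel₀ ha0, one_pow]
      rw [h9, Nat.add_sub_cancel]
      have h12 := h6 (n + 1)
      rw [sum_range_succ] at h12
      simp only [id]
      linear_combination (-a * u ^ n) * h12 - (∑ m ∈ range n, a ^ m * c m + a ^ n * c n) * u ^ n * h10
        - c n * u ^ n * h11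

/-- Uniqueness of primitives. Derivatives are compared only on the open interval because du/u is
singular at 0; continuity at 0 then fixes the constant. -/
theorem eq_mul_powSum_of_hasDerivAt {g g' : ℝ → ℂ} (hg : ContinuousOn g (Set.Ico 0 1))
    (hg0 : g 0 = 0) (hd : ∀ u ∈ Set.Ioo (0 : ℝ) 1, HasDerivAt g (g' u) u) {c e : ℕ → ℂ}
    {φ : ℝ → ℂ} (he : IsPrimitive c e φ) {θ : ℂ}
    (h : ∀ u ∈ Set.Ioo (0 : ℝ) 1, g' u = θ * (φ u * powSum c id u)) :
    ∀ u ∈ Set.Ico (0 : ℝ) 1, g u = θ * powSum e id u := by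
  intro u hu
  have hid : ∀ n : ℕ, id n ≤ 2 * n + 1 := fun n => by simp only [id]; omega
  obtain ⟨G, hG⟩ : ∃ G : ℝ → ℂ, G = fun x => g x - θ * powSum e id x := ⟨_, rfl⟩
  have hG0 : G 0 = 0 := by
    simp only [hG, hg0]
    rw [powSum_zero (a := e) (k := id) fun n => by
      rcases n with _ | n
      · exact Or.inl he.apply_zero
      · exact Or.inr n.succ_ne_zero]
    simp
  have hcont : ContinuousOn G (Set.Ico 0 1) := by
    rw [hG]
    refine hg.sub (continuousOn_const.mul fun x hx => ?_)
    exact (hasDerivAt_powSum he.polyBounded (k := id) (fun n => le_rfl) hid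
      (abs_lt.2 ⟨by linarith [hx.1], hx.2⟩)).2.continuousAt.continuousWithinAt
  have hderiv : ∀ x ∈ Set.Ioo (0 : ℝ) 1, HasDerivAt G 0 x := by
    intro x hx
    have h1 := (he.hasSum x hx).hasDerivAt_powSum he.polyBounded (k := id) (fun n => le_rfl) hid
      (abs_lt.2 ⟨by linarith [hx.1], hx.2⟩)
    rw [hG]
    have h2 := (hd x hx).sub (h1.const_mul θ)
    rwa [h x hx, sub_self] at h2
  rcases hu.1.eq_or_lt with rfl | hu0
  · have := hG0
    rwa [hG, sub_eq_zero] at this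
  have hconst : ∀ x ∈ Set.Ioo (0 : ℝ) u, G u = G x := fun x hx =>
    constant_of_has_deriv_right_zero (hcont.mono fun y hy => ⟨by linarith [hx.1, hy.1],
      hy.2.trans_lt hu.2⟩) (fun y hy => (hderiv y ⟨by linarith [hx.1, hy.1],
      hy.2.trans hu.2⟩).hasDerivWithinAt) u ⟨hx.2.le, le_rfl⟩
  have hlim : Filter.Tendsto G (nhdsWithin 0 (Set.Ioo 0 u)) (nhds (G 0)) :=
    (hcont 0 ⟨le_rfl, one_pos⟩).mono_left
      (nhdsWithin_mono _ fun y hy => ⟨hy.1.le, hy.2.trans hu.2⟩)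
  have : (nhdsWithin (0 : ℝ) (Set.Ioo 0 u)).NeBot := left_nhdsWithin_Ioo_neBot hu0
  have h3 : G u = G 0 := tendsto_nhds_unique (tendsto_const_nhds.congr'
    (Filter.eventually_of_mem self_mem_nhdsWithin hconst)) hlim
  rwa [hG0, hG, sub_eq_zero] at h3

end PowerSeries

/-! ### The substitution y = sin t, u = tan (t/2) -/

section Substitution

/-- `sin t = 2u / (1 + u²)` for `u = tan (t / 2)`. -/
noncomputable def sinSub (u : ℝ) : ℝ := 2 * u / (1 + u ^ 2)

/-- `cos t = (1 - u²) / (1 + u²)` for `u = tan (t / 2)`. -/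
noncomputable def cosSub (u : ℝ) : ℝ := (1 - u ^ 2) / (1 + u ^ 2)

theorem one_add_sq_pos (u : ℝ) : 0 < 1 + u ^ 2 := by positivity

theorem sinSub_sq_add_cosSub_sq (u : ℝ) : sinSub u ^ 2 + cosSub u ^ 2 = 1 := by
  have := (one_add_sq_pos u).ne'
  simp only [sinSub, cosSub]
  field_simp
  ring

theorem sinSub_nonneg {u : ℝ} (hu : 0 ≤ u) : 0 ≤ sinSub u :=
  div_nonneg (by linarith) (one_add_sq_pos u).le

theorem sinSub_lt_one {u : ℝ} (hu : u < 1) : sinSub u < 1 := by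
  rw [sinSub, div_lt_one (one_add_sq_pos u)]
  nlinarith [sq_pos_of_pos (sub_pos.2 hu)]

theorem abs_sinSub_lt_one {u : ℝ} (hu : u ∈ Set.Ico (0 : ℝ) 1) : |sinSub u| < 1 := by
  rw [abs_of_nonneg (sinSub_nonneg hu.1)]
  exact sinSub_lt_one hu.2

theorem hasDerivAt_sinSub (u : ℝ) : HasDerivAt sinSub (2 / (1 + u ^ 2) * cosSub u) u := by
  have h := ((hasDerivAt_id u).const_mul 2).div (((hasDerivAt_id u).pow 2).const_add 1)
    (one_add_sq_pos u).ne'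
  refine h.congr_deriv ?_
  have := (one_add_sq_pos u).ne'
  simp only [cosSub, Pi.pow_apply, id]
  field_simp
  ring

theorem hasDerivAt_cosSub (u : ℝ) : HasDerivAt cosSub (-(2 / (1 + u ^ 2) * sinSub u)) u := by
  have h := (((hasDerivAt_id u).pow 2).const_sub 1).div (((hasDerivAt_id u).pow 2).const_add 1)
    (one_add_sq_pos u).ne'
  refine h.congr_deriv ?_
  have := (one_add_sq_pos u).ne'
  simp only [sinSub, Pi.pow_apply, id]
  field_simp
  ring

/-- The generating function `∑ b_n A_n y ^ {k_n}`. -/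
noncomputable def genSum (A : ℕ → ℝ) (k : ℕ → ℕ) : ℝ → ℂ :=
  powSum (fun n => ((bCoeff n * A n : ℝ) : ℂ)) k

/-- The exponents `2n`. -/
def evenExp (n : ℕ) : ℕ := 2 * n

/-- The exponents `2n + 1`. -/
def oddExp (n : ℕ) : ℕ := 2 * n + 1

/-- The sequence `(∑_{m ≤ n} A_m) / (2n + 1)`. -/
noncomputable def oddSum (A : ℕ → ℝ) (n : ℕ) : ℝ :=
  LinForm.oddPlus.recip n * ∑ m ∈ range (n + 1), A m

/-- The sequence `(∑_{m < n} A_m) / (2n)`. -/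
noncomputable def evenSum (A : ℕ → ℝ) (n : ℕ) : ℝ :=
  LinForm.even.recip n * ∑ m ∈ range n, A m

theorem Decays.polyBounded_bCoeff_mul {A : ℕ → ℝ} (hA : Decays (1 / 2) A) :
    PolyBounded fun n => ((bCoeff n * A n : ℝ) : ℂ) := by
  obtain ⟨C, hC⟩ := decays_bCoeff.mul hA
  refine ⟨C, 0, fun n => ?_⟩
  have := hC n
  norm_num at this ⊢
  exact this

theorem Decays.oddSum {A : ℕ → ℝ} (hA : Decays (3 / 4) A) : Decays (3 / 4) (oddSum A) := by
  have := hA.mul_sum (LinForm.oddPlus.decays_recip_pow (le_refl 1)) fun n => subset_rfl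
  norm_num at this
  exact this

theorem Decays.half {A : ℕ → ℝ} (hA : Decays (3 / 4) A) : Decays (1 / 2) A :=
  hA.mono (by norm_num) fun _ => norm_nonneg _

theorem le_evenExp (n : ℕ) : n ≤ evenExp n := by rw [evenExp]; omega
theorem le_oddExp (n : ℕ) : n ≤ oddExp n := by rw [oddExp]; omega
theorem evenExp_le (n : ℕ) : evenExp n ≤ 2 * n + 1 := by rw [evenExp]; omega
theorem oddExp_le (n : ℕ) : oddExp n ≤ 2 * n + 1 := by rw [oddExp]

variable {A : ℕ → ℝ} {y : ℝ}

theorem hasSum_genSum (hA : Decays (3 / 4) A) {k : ℕ → ℕ} (hk : ∀ n, n ≤ k n) (hy : |y| < 1) :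
    HasSum (fun n => ((bCoeff n * A n : ℝ) : ℂ) * (y : ℂ) ^ k n) (genSum A k y) :=
  hasSum_powSum hA.half.polyBounded_bCoeff_mul hk hy

theorem bCoeff_succ_mul_recip (n : ℕ) :
    bCoeff (n + 1) * LinForm.even.recip (n + 1) = bCoeff n * LinForm.oddPlus.recip n := by
  rw [bCoeff_succ, LinForm.recip_even, LinForm.recip_oddPlus]
  have : (2 * n + 1 : ℝ) ≠ 0 := by positivity
  have : (2 * (n + 1) : ℝ) ≠ 0 := by positivity
  push_cast
  field_simp

theorem bCoeff_succ' (n : ℕ) :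
    bCoeff (n + 1) = bCoeff n + bCoeff n * LinForm.oddPlus.recip n := by
  rw [bCoeff_succ, LinForm.recip_oddPlus]
  have : (2 * n + 1 : ℝ) ≠ 0 := by positivity
  field_simp
  ring

/-- A shift of the index, with b_{n+1}/(2n+2) = b_n/(2n+1). After the substitution the left side is
tan t times `angleInt`. -/
theorem genSum_evenSum (hA : Decays (3 / 4) A) (hB : Decays (3 / 4) (evenSum A)) (hy : |y| < 1) :
    genSum (evenSum A) evenExp y = y * genSum (oddSum A) oddExp y := by
  have h1 := (hasSum_nat_add_iff' 1).2 (hasSum_genSum hB le_evenExp hy)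
  have h2 := (hasSum_genSum hA.oddSum le_oddExp hy).mul_left (y : ℂ)
  have h3 := h1.unique (h2.congr_fun fun n => ?_)
  · rw [← h3]
    simp [evenSum]
  · have h4 : bCoeff (n + 1) * evenSum A (n + 1) = bCoeff n * oddSum A n := by
      rw [evenSum, oddSum, ← mul_assoc, bCoeff_succ_mul_recip, mul_assoc]
    rw [h4, oddExp, evenExp, pow_succ _ (2 * n), mul_add, pow_add]
    ring

theorem mul_genSum (hA : Decays (3 / 4) A) (hy : |y| < 1) :
    y * genSum A evenExp y = genSum A oddExp y := by
  refine ((hasSum_genSum hA le_evenExp hy).mul_left (y : ℂ)).unique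
    ((hasSum_genSum hA le_oddExp hy).congr_fun fun n => ?_)
  rw [oddExp, evenExp, pow_succ]
  ring

theorem hasDerivAt_genSum (hA : Decays (3 / 4) A) {k : ℕ → ℕ} (hk : ∀ n, n ≤ k n)
    (hk' : ∀ n, k n ≤ 2 * n + 1) (hy : |y| < 1) : ∃ D, HasDerivAt (genSum A k) D y ∧
      HasSum (fun n => ((bCoeff n * A n : ℝ) : ℂ) * (k n * (y : ℂ) ^ (k n - 1))) D := by
  obtain ⟨h1, h2⟩ := hasDerivAt_powSum hA.half.polyBounded_bCoeff_mul hk hk' hy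
  exact ⟨_, h2, h1.hasSum⟩

/-- The operator y d/dy multiplies by the exponent `k n`. With exponents 2n or 2n+1 matching the
outer form, it lowers the outer power by one. -/
theorem hasDerivAt_genSum_of_mul {B : ℕ → ℝ} (hA : Decays (3 / 4) A) (hB : Decays (3 / 4) B)
    {k : ℕ → ℕ} (hk : ∀ n, n ≤ k n) (hk' : ∀ n, k n ≤ 2 * n + 1) (hAB : ∀ n, B n * k n = A n)
    (hy : |y| < 1) (hy0 : y ≠ 0) : HasDerivAt (genSum B k) ((y : ℂ)⁻¹ * genSum A k y) y := by
  obtain ⟨D, hD, hs⟩ := hasDerivAt_genSum hB hk hk' hy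
  have hy0' : (y : ℂ) ≠ 0 := by exact_mod_cast hy0
  have h1 := (hs.mul_left (y : ℂ)).unique ((hasSum_genSum hA hk hy).congr_fun fun n => ?_)
  · rwa [← h1, inv_mul_cancel_left₀ hy0']
  · rw [← hAB]
    rcases Nat.eq_zero_or_pos (k n) with h | h
    · simp [h]
    · rw [← mul_pow_sub_one h.ne' (y : ℂ)]
      push_cast
      ring

/-- Comparing coefficients: 2n+1 cancels the denominator of `oddSum`, consecutive partial sums
differ by one A, and (2n+1) b_{n+1} = (2n+2) b_n removes the rest. -/
theorem hasDerivAt_genSum_oddSum (hA : Decays (3 / 4) A) (hy : |y| < 1) :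
    ∃ D, HasDerivAt (genSum (oddSum A) oddExp) D y ∧
      (1 - (y : ℂ) ^ 2) * D - y * genSum (oddSum A) oddExp y = genSum A evenExp y := by
  obtain ⟨D, hD, hs⟩ := hasDerivAt_genSum hA.oddSum le_oddExp oddExp_le hy
  refine ⟨D, hD, ?_⟩
  have h1 := (hasSum_nat_add_iff' 1).2 hs
  have h2 := hs.mul_left ((y : ℂ) ^ 2)
  have h3 := (hasSum_genSum hA.oddSum le_oddExp hy).mul_left (y : ℂ)
  have h4 := (hasSum_nat_add_iff' 1).2 (hasSum_genSum hA le_evenExp hy)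
  have h5 := h4.unique (((h1.sub h2).sub h3).congr_fun fun n => ?_)
  · have h6 : oddSum A 0 = A 0 := by simp [oddSum, LinForm.recip_oddPlus]
    simp [h6, oddExp, evenExp] at h5
    linear_combination -h5
  · have h7 : ∀ m : ℕ, oddSum A m * (2 * m + 1) = ∑ j ∈ range (m + 1), A j := by
      intro m
      rw [oddSum, LinForm.recip_oddPlus]
      have : (2 * m + 1 : ℝ) ≠ 0 := by positivity
      field_simp
    have h8 : bCoeff (n + 1) * A (n + 1) = bCoeff (n + 1) * oddSum A (n + 1) * (2 * (n + 1) + 1) -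
        bCoeff n * oddSum A n * (2 * n + 1) - bCoeff n * oddSum A n := by
      have h9 := h7 (n + 1)
      rw [sum_range_succ, ← h7 n] at h9
      push_cast at h9
      have h10 : bCoeff (n + 1) * (2 * n + 1) = bCoeff n * (2 * n + 2) := by
        rw [bCoeff_succ]
        field_simp
      linear_combination (-bCoeff (n + 1)) * h9 - oddSum A n * h10
    rw [h8]
    simp only [oddExp, evenExp, Nat.add_sub_cancel, pow_succ, mul_add, pow_mul]
    push_cast
    ring

/-- `cos t · ∑ b_n (∑_{m ≤ n} A_m) sin^{2n+1} t / (2n + 1) = ∫₀ᵗ ∑ b_n A_n sin^{2n} τ dτ`. -/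
noncomputable def angleInt (A : ℕ → ℝ) (u : ℝ) : ℂ :=
  cosSub u * genSum (oddSum A) oddExp (sinSub u)

theorem hasDerivAt_angleInt (hA : Decays (3 / 4) A) {u : ℝ} (hu : u ∈ Set.Ico (0 : ℝ) 1) :
    HasDerivAt (angleInt A) ((2 / (1 + u ^ 2) : ℝ) * genSum A evenExp (sinSub u)) u := by
  obtain ⟨D, hD, h⟩ := hasDerivAt_genSum_oddSum hA (abs_sinSub_lt_one hu)
  have h1 := (hasDerivAt_cosSub u).ofReal_comp.mul (hD.scomp u (hasDerivAt_sinSub u))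
  refine h1.congr_deriv ?_
  rw [← h]
  have h2 := congrArg (Complex.ofReal) (sinSub_sq_add_cosSub_sq u)
  push_cast at h2
  simp only [Complex.real_smul, Function.comp_apply, Complex.ofReal_mul, Complex.ofReal_neg]
  -- The derivative falling on the series gives cos² t, which is 1 - y² in the differential
  -- equation.
  linear_combination (((2 / (1 + u ^ 2) : ℝ) : ℂ) * D) * h2

theorem angleInt_zero (A : ℕ → ℝ) : angleInt A 0 = 0 := by
  have h1 : sinSub 0 = 0 := by simp [sinSub]
  rw [angleInt, h1, genSum, powSum_zero fun n => Or.inr (by rw [oddExp]; omega), mul_zero]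

theorem genSum_sinSub_zero {k : ℕ → ℕ} (h : ∀ n, A n = 0 ∨ k n ≠ 0) :
    genSum A k (sinSub 0) = 0 := by
  have h1 : sinSub 0 = 0 := by simp [sinSub]
  rw [h1, genSum, powSum_zero fun n => (h n).imp_left fun h => by simp [h]]

theorem continuousOn_angleInt (hA : Decays (3 / 4) A) :
    ContinuousOn (angleInt A) (Set.Ico 0 1) := fun _ hu =>
  (hasDerivAt_angleInt hA hu).continuousAt.continuousWithinAt

theorem continuousOn_genSum_sinSub (hA : Decays (3 / 4) A) {k : ℕ → ℕ} (hk : ∀ n, n ≤ k n)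
    (hk' : ∀ n, k n ≤ 2 * n + 1) :
    ContinuousOn (fun u => genSum A k (sinSub u)) (Set.Ico 0 1) := fun u hu => by
  obtain ⟨D, hD, -⟩ := hasDerivAt_genSum hA hk hk' (abs_sinSub_lt_one hu)
  exact (hD.scomp u (hasDerivAt_sinSub u)).continuousAt.continuousWithinAt

theorem sinSub_ne_zero {u : ℝ} (hu : u ∈ Set.Ioo (0 : ℝ) 1) : sinSub u ≠ 0 :=
  div_ne_zero (mul_ne_zero two_ne_zero hu.1.ne') (one_add_sq_pos u).ne'

theorem hasDerivAt_genSum_sinSub {B : ℕ → ℝ} (hA : Decays (3 / 4) A) (hB : Decays (3 / 4) B)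
    {k : ℕ → ℕ} (hk : ∀ n, n ≤ k n) (hk' : ∀ n, k n ≤ 2 * n + 1) (hAB : ∀ n, B n * k n = A n)
    {u : ℝ} (hu : u ∈ Set.Ioo (0 : ℝ) 1) :
    HasDerivAt (fun u => genSum B k (sinSub u))
      ((2 / (1 + u ^ 2) * cosSub u * (sinSub u)⁻¹ : ℝ) * genSum A k (sinSub u)) u := by
  have h1 := hasDerivAt_genSum_of_mul hA hB hk hk' hAB
    (abs_sinSub_lt_one (Set.Ioo_subset_Ico_self hu)) (sinSub_ne_zero hu)
  refine (h1.scomp u (hasDerivAt_sinSub u)).congr_deriv ?_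
  simp only [Complex.real_smul]
  push_cast
  ring

end Substitution

/-! ### Standard sums: iterated integrals in u and their values at u = 1 -/

section Standard

/-- The nested sums with default signs. -/
noncomputable def stdSeq (L : List (LinForm × ℕ)) : ℕ → ℝ :=
  chainSeq (formChain (L.map fun p => (p.1, p.1.sign, p.2)))

theorem stdSeq_nil : stdSeq [] = Pi.single 0 1 := rfl

theorem stdSeq_cons (l : LinForm) (s : ℕ) (L : List (LinForm × ℕ)) (n : ℕ) :
    stdSeq ((l, s) :: L) n = l.recip n ^ s * ∑ m ∈ l.sign.below n, stdSeq L m := rfl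

/-- Only `2n` and `2n + 1` occur, with positive exponents. -/
def Plain (L : List (LinForm × ℕ)) : Prop := ∀ p ∈ L, p.1 ≠ .oddMinus ∧ 1 ≤ p.2

theorem plain_nil : Plain [] := fun _ h => absurd h List.not_mem_nil

theorem plain_cons {l : LinForm} {s : ℕ} {L : List (LinForm × ℕ)} :
    Plain ((l, s) :: L) ↔ (l ≠ .oddMinus ∧ 1 ≤ s) ∧ Plain L := by
  simp [Plain]

/-- The sum of the exponents. -/
def listWeight (L : List (LinForm × ℕ)) : ℕ := (L.map Prod.snd).sum

theorem listWeight_cons (l : LinForm) (s : ℕ) (L : List (LinForm × ℕ)) :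
    listWeight ((l, s) :: L) = s + listWeight L := by simp [listWeight]

theorem Plain.decays {L : List (LinForm × ℕ)} (hL : Plain L) : Decays (3 / 4) (stdSeq L) := by
  refine decays_formChain fun p hp => ?_
  obtain ⟨q, hq, rfl⟩ := List.mem_map.1 hp
  exact (hL q hq).2

theorem I_sub_ne_zero (u : ℝ) : Complex.I - u ≠ 0 := fun h => by
  simpa using congrArg Complex.im h

theorem neg_I_sub_ne_zero (u : ℝ) : -Complex.I - u ≠ 0 := fun h => by
  simpa using congrArg Complex.im h

theorem one_add_sq_ne_zero (u : ℝ) : (1 + (u : ℂ) ^ 2) ≠ 0 := by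
  exact_mod_cast (one_add_sq_pos u).ne'

theorem inv_I_sub (u : ℝ) : (Complex.I - u)⁻¹ = (-Complex.I - u) / (1 + (u : ℂ) ^ 2) := by
  rw [eq_div_iff (one_add_sq_ne_zero u), inv_mul_eq_iff_eq_mul₀ (I_sub_ne_zero u)]
  linear_combination Complex.I_sq

theorem inv_neg_I_sub (u : ℝ) : (-Complex.I - u)⁻¹ = (Complex.I - u) / (1 + (u : ℂ) ^ 2) := by
  rw [eq_div_iff (one_add_sq_ne_zero u), inv_mul_eq_iff_eq_mul₀ (neg_I_sub_ne_zero u)]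
  linear_combination Complex.I_sq

section Primitives

variable {w : ℕ} {c : ℕ → ℂ}

theorem isPrimitive_intOp_I (hc : c ∈ polySpan w) :
    IsPrimitive c (intOp Complex.I c) fun u => (-Complex.I - u) / (1 + (u : ℂ) ^ 2) := by
  simpa only [inv_I_sub] using isPrimitive_intOp Complex.I_pow_four hc fun u _ => I_sub_ne_zero u

theorem neg_I_pow_four : (-Complex.I) ^ 4 = 1 := by rw [Even.neg_pow ⟨2, rfl⟩, Complex.I_pow_four]

theorem isPrimitive_intOp_neg_I (hc : c ∈ polySpan w) :
    IsPrimitive c (intOp (-Complex.I) c) fun u => (Complex.I - u) / (1 + (u : ℂ) ^ 2) := by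
  simpa only [inv_neg_I_sub] using
    isPrimitive_intOp neg_I_pow_four hc fun u _ => neg_I_sub_ne_zero u

theorem isPrimitive_intOp_one (hc : c ∈ polySpan w) :
    IsPrimitive c (intOp 1 c) fun u => (1 - (u : ℂ))⁻¹ :=
  isPrimitive_intOp (one_pow 4) hc fun u hu => by
    rw [sub_ne_zero]; exact_mod_cast hu.2.ne'

theorem isPrimitive_intOp_neg_one (hc : c ∈ polySpan w) :
    IsPrimitive c (intOp (-1) c) fun u => (-1 - (u : ℂ))⁻¹ :=
  isPrimitive_intOp (by norm_num) hc fun u hu => by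
    rw [sub_ne_zero]
    have : (-1 : ℝ) ≠ u := by linarith [hu.1]
    exact_mod_cast this

theorem I_ne_one : Complex.I ≠ 1 := fun h => by simpa using congrArg Complex.im h

theorem neg_I_ne_one : -Complex.I ≠ 1 := fun h => by simpa using congrArg Complex.im h

end Primitives

variable {L : List (LinForm × ℕ)}

/-- The primitive of `sin^{2n}` attached to a standard sequence is `i` times a power series in
`u = tan (t / 2)` with coefficients in the span of the polylogarithm coefficients. -/
def HasAngleRep (L : List (LinForm × ℕ)) : Prop :=
  ∃ c ∈ polySpan (listWeight L + 1), ∀ u ∈ Set.Ico (0 : ℝ) 1,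
    angleInt (stdSeq L) u = Complex.I * powSum c id u

theorem stdSeq_even_one (L : List (LinForm × ℕ)) :
    stdSeq ((.even, 1) :: L) = evenSum (stdSeq L) := by
  funext n
  rw [stdSeq_cons, evenSum, pow_one]
  rfl

theorem stdSeq_oddPlus_one (L : List (LinForm × ℕ)) :
    stdSeq ((.oddPlus, 1) :: L) = oddSum (stdSeq L) := by
  funext n
  rw [stdSeq_cons, oddSum, pow_one]
  rfl

theorem stdSeq_even_zero (s : ℕ) (L : List (LinForm × ℕ)) : stdSeq ((.even, s) :: L) 0 = 0 := by
  simp [stdSeq_cons, LinForm.sign, IneqSign.below]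

theorem stdSeq_even_mul (s : ℕ) (L : List (LinForm × ℕ)) (n : ℕ) :
    stdSeq ((.even, s + 1) :: L) n * evenExp n = stdSeq ((.even, s) :: L) n := by
  rcases Nat.eq_zero_or_pos n with rfl | hn
  · simp [stdSeq_even_zero]
  · have : (n : ℝ) ≠ 0 := by exact_mod_cast hn.ne'
    rw [stdSeq_cons, stdSeq_cons, LinForm.recip_even, evenExp, pow_succ]
    push_cast
    field_simp

theorem stdSeq_oddPlus_mul (s : ℕ) (L : List (LinForm × ℕ)) (n : ℕ) :
    stdSeq ((.oddPlus, s + 1) :: L) n * oddExp n = stdSeq ((.oddPlus, s) :: L) n := by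
  have : (2 * n + 1 : ℝ) ≠ 0 := by positivity
  rw [stdSeq_cons, stdSeq_cons, LinForm.recip_oddPlus, oddExp, pow_succ]
  push_cast
  field_simp

theorem plain_even {s : ℕ} (hs : 1 ≤ s) (hL : Plain L) : Plain ((.even, s) :: L) :=
  plain_cons.2 ⟨⟨by simp, hs⟩, hL⟩

theorem plain_oddPlus {s : ℕ} (hs : 1 ≤ s) (hL : Plain L) : Plain ((.oddPlus, s) :: L) :=
  plain_cons.2 ⟨⟨by simp, hs⟩, hL⟩

theorem cosSub_ne_zero {u : ℝ} (hu : u ∈ Set.Ioo (0 : ℝ) 1) : cosSub u ≠ 0 := by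
  refine div_ne_zero ?_ (one_add_sq_pos u).ne'
  nlinarith [hu.1, hu.2]

/-- This is cot t dt = d log sin t with sin t = 2u/(1 + u²), split over the poles 0, i and -i. -/
theorem log_deriv_sinSub {u : ℝ} (hu : u ∈ Set.Ioo (0 : ℝ) 1) :
    ((2 / (1 + u ^ 2) * cosSub u * (sinSub u)⁻¹ : ℝ) : ℂ) = (u : ℂ)⁻¹ +
      (-Complex.I - u) / (1 + (u : ℂ) ^ 2) + (Complex.I - u) / (1 + (u : ℂ) ^ 2) := by
  have h1 := one_add_sq_ne_zero u
  have h2 : (u : ℂ) ≠ 0 := by exact_mod_cast hu.1.ne'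
  simp only [cosSub, sinSub]
  push_cast
  field_simp
  ring

/-- For exponent 2 the integrand is cot t · tan t · `angleInt` dt, so only dt is left; its factor i
cancels that of `angleInt` up to sign. Each further power integrates against cot t dt. No pole at 1
occurs, whence `convSpan`. -/
theorem exists_genSum_even (hL : Plain L) (h : HasAngleRep L) (s : ℕ) :
    ∃ c ∈ convSpan (listWeight ((.even, s + 2) :: L)), ∀ u ∈ Set.Ico (0 : ℝ) 1,
      genSum (stdSeq ((.even, s + 2) :: L)) evenExp (sinSub u) = powSum c id u := by
  induction s with
  | zero =>
    obtain ⟨c, hc, hrep⟩ := h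
    refine ⟨-(intOp Complex.I c + -intOp (-Complex.I) c), ?_, ?_⟩
    · rw [listWeight_cons, zero_add, add_comm]
      exact neg_mem (add_mem (intOp_mem_convSpan Complex.I_pow_four I_ne_one hc)
        (neg_mem (intOp_mem_convSpan neg_I_pow_four neg_I_ne_one hc)))
    intro u hu
    rw [← one_mul (powSum _ _ _)]
    refine eq_mul_powSum_of_hasDerivAt (c := c)
      (continuousOn_genSum_sinSub (plain_even (by norm_num) hL).decays le_evenExp evenExp_le)
      (genSum_sinSub_zero fun n => ?_)
      (fun u hu => hasDerivAt_genSum_sinSub (plain_even le_rfl hL).decays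
        (plain_even (by norm_num) hL).decays le_evenExp evenExp_le (stdSeq_even_mul 1 L) hu)
      ((isPrimitive_intOp_I hc).add (isPrimitive_intOp_neg_I hc).neg).neg ?_ u hu
    · rcases n with _ | n
      · exact Or.inl (stdSeq_even_zero _ _)
      · exact Or.inr (by rw [evenExp]; omega)
    · intro u hu
      have hu' := Set.Ioo_subset_Ico_self hu
      have h1 := hrep u hu'
      have h2 := (plain_even (s := 1) le_rfl hL).decays
      rw [stdSeq_even_one] at h2 ⊢
      rw [genSum_evenSum hL.decays h2 (abs_sinSub_lt_one hu')]
      rw [angleInt] at h1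
      have h3 : (sinSub u : ℂ) ≠ 0 := by exact_mod_cast sinSub_ne_zero hu
      have h4 := one_add_sq_ne_zero u
      simp only [Pi.neg_apply, Pi.add_apply]
      push_cast
      calc _ = 2 / (1 + (u : ℂ) ^ 2) * (cosSub u *
            genSum (oddSum (stdSeq L)) oddExp (sinSub u)) := by field_simp
        _ = _ := by
          rw [h1]
          field_simp
          ring
  | succ s ih =>
    obtain ⟨c, hc, hrep⟩ := ih
    have hc' := convSpan_le_polySpan _ hc
    have hc0 : c 0 = 0 := by
      rw [listWeight_cons, add_right_comm] at hc'
      exact apply_zero_of_mem_polySpan hc'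
    refine ⟨divOp c + intOp Complex.I c + intOp (-Complex.I) c, ?_, ?_⟩
    · have : listWeight ((.even, s + 1 + 2) :: L) = listWeight ((.even, s + 2) :: L) + 1 := by
        simp only [listWeight_cons]; ring
      rw [this]
      exact add_mem (add_mem (divOp_mem hc') (intOp_mem_convSpan Complex.I_pow_four I_ne_one hc'))
        (intOp_mem_convSpan neg_I_pow_four neg_I_ne_one hc')
    intro u hu
    rw [← one_mul (powSum _ _ _)]
    refine eq_mul_powSum_of_hasDerivAt (c := c)
      (continuousOn_genSum_sinSub (plain_even (by omega) hL).decays le_evenExp evenExp_le)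
      (genSum_sinSub_zero fun n => ?_)
      (fun u hu => hasDerivAt_genSum_sinSub (plain_even (by omega) hL).decays
        (plain_even (by omega) hL).decays le_evenExp evenExp_le (stdSeq_even_mul (s + 2) L) hu)
      (((isPrimitive_divOp hc' hc0).add (isPrimitive_intOp_I hc')).add
        (isPrimitive_intOp_neg_I hc')) ?_ u hu
    · rcases n with _ | n
      · exact Or.inl (stdSeq_even_zero _ _)
      · exact Or.inr (by rw [evenExp]; omega)
    · intro u hu
      rw [hrep u (Set.Ioo_subset_Ico_self hu), log_deriv_sinSub hu, one_mul]
      rfl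

theorem two_div_mul_inv_sinSub {u : ℝ} (hu : u ∈ Set.Ioo (0 : ℝ) 1) :
    2 / (1 + u ^ 2) * (sinSub u)⁻¹ = u⁻¹ := by
  have h1 := (one_add_sq_pos u).ne'
  have h2 := hu.1.ne'
  rw [sinSub]
  field_simp

/-- For exponent 2 the integrand is cot t · `angleInt` / cos t dt, that is `angleInt` · du/u, so the
factor i survives. Each further power integrates against cot t dt. -/
theorem exists_genSum_oddPlus (hL : Plain L) (h : HasAngleRep L) (s : ℕ) :
    ∃ c ∈ convSpan (listWeight ((.oddPlus, s + 2) :: L)), ∀ u ∈ Set.Ico (0 : ℝ) 1,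
      genSum (stdSeq ((.oddPlus, s + 2) :: L)) oddExp (sinSub u) =
        Complex.I * powSum c id u := by
  induction s with
  | zero =>
    obtain ⟨c, hc, hrep⟩ := h
    refine ⟨divOp c, ?_, ?_⟩
    · rw [listWeight_cons, zero_add, add_comm]
      exact divOp_mem hc
    intro u hu
    refine eq_mul_powSum_of_hasDerivAt (c := c)
      (continuousOn_genSum_sinSub (plain_oddPlus (by norm_num) hL).decays le_oddExp oddExp_le)
      (genSum_sinSub_zero fun n => Or.inr (by rw [oddExp]; omega))
      (fun u hu => hasDerivAt_genSum_sinSub (plain_oddPlus le_rfl hL).decays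
        (plain_oddPlus (by norm_num) hL).decays le_oddExp oddExp_le (stdSeq_oddPlus_mul 1 L) hu)
      (isPrimitive_divOp hc (apply_zero_of_mem_polySpan hc)) ?_ u hu
    intro u hu
    have h1 := hrep u (Set.Ioo_subset_Ico_self hu)
    rw [stdSeq_oddPlus_one]
    rw [angleInt] at h1
    have h2 := congrArg Complex.ofReal (two_div_mul_inv_sinSub hu)
    push_cast at h2 ⊢
    linear_combination (u : ℂ)⁻¹ * h1 + h2 * cosSub u *
      genSum (oddSum (stdSeq L)) oddExp (sinSub u)
  | succ s ih =>
    obtain ⟨c, hc, hrep⟩ := ih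
    have hc' := convSpan_le_polySpan _ hc
    have hc0 : c 0 = 0 := by
      rw [listWeight_cons, add_right_comm] at hc'
      exact apply_zero_of_mem_polySpan hc'
    refine ⟨divOp c + intOp Complex.I c + intOp (-Complex.I) c, ?_, ?_⟩
    · have : listWeight ((.oddPlus, s + 1 + 2) :: L) = listWeight ((.oddPlus, s + 2) :: L) + 1 := by
        simp only [listWeight_cons]; ring
      rw [this]
      exact add_mem (add_mem (divOp_mem hc') (intOp_mem_convSpan Complex.I_pow_four I_ne_one hc'))
        (intOp_mem_convSpan neg_I_pow_four neg_I_ne_one hc')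
    intro u hu
    refine eq_mul_powSum_of_hasDerivAt (c := c)
      (continuousOn_genSum_sinSub (plain_oddPlus (by omega) hL).decays le_oddExp oddExp_le)
      (genSum_sinSub_zero fun n => Or.inr (by rw [oddExp]; omega))
      (fun u hu => hasDerivAt_genSum_sinSub (plain_oddPlus (by omega) hL).decays
        (plain_oddPlus (by omega) hL).decays le_oddExp oddExp_le (stdSeq_oddPlus_mul (s + 2) L) hu)
      (((isPrimitive_divOp hc' hc0).add (isPrimitive_intOp_I hc')).add
        (isPrimitive_intOp_neg_I hc')) ?_ u hu
    intro u hu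
    rw [hrep u (Set.Ioo_subset_Ico_self hu), log_deriv_sinSub hu, mul_left_comm]
    rfl

theorem hasAngleRep_of_deriv (hL : Plain L) {c e : ℕ → ℂ} {φ : ℝ → ℂ} (he : IsPrimitive c e φ)
    (hmem : e ∈ polySpan (listWeight L + 1))
    (h : ∀ u ∈ Set.Ioo (0 : ℝ) 1, ((2 / (1 + u ^ 2) : ℝ) : ℂ) *
      genSum (stdSeq L) evenExp (sinSub u) = Complex.I * (φ u * powSum c id u)) :
    HasAngleRep L :=
  ⟨e, hmem, eq_mul_powSum_of_hasDerivAt (continuousOn_angleInt hL.decays) (angleInt_zero _)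
    (fun _ hu => hasDerivAt_angleInt hL.decays (Set.Ioo_subset_Ico_self hu)) he h⟩

/-- One integration against dt = i ((i - u)⁻¹ - (-i - u)⁻¹) du, which supplies the factor i. -/
theorem hasAngleRep_of_genSum (hL : Plain L) {c : ℕ → ℂ} (hc : c ∈ polySpan (listWeight L))
    (h : ∀ u ∈ Set.Ico (0 : ℝ) 1, genSum (stdSeq L) evenExp (sinSub u) = powSum c id u) :
    HasAngleRep L := by
  refine hasAngleRep_of_deriv hL ((isPrimitive_intOp_I hc).add (isPrimitive_intOp_neg_I hc).neg)
    (add_mem (intOp_mem Complex.I_pow_four hc) (neg_mem (intOp_mem neg_I_pow_four hc)))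
    fun u hu => ?_
  rw [h u (Set.Ioo_subset_Ico_self hu)]
  have h1 := one_add_sq_ne_zero u
  simp only [Pi.add_apply, Pi.neg_apply]
  push_cast
  field_simp
  linear_combination (2 * powSum c id u) * Complex.I_sq

/-- The poles at ±1 come from cos t in a denominator, hence only from outer exponent 1. -/
theorem inv_one_sub_add {u : ℝ} (hu : u ∈ Set.Ioo (0 : ℝ) 1) :
    (1 - (u : ℂ))⁻¹ + (-1 - (u : ℂ))⁻¹ = 2 * u / ((1 + u ^ 2) * cosSub u) := by
  have h1 := one_add_sq_ne_zero u
  have h2 : (1 - (u : ℂ)) ≠ 0 := by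
    rw [sub_ne_zero]; exact_mod_cast hu.2.ne'
  have h3 : (-1 - (u : ℂ)) ≠ 0 := by
    rw [sub_ne_zero]
    have : (-1 : ℝ) ≠ u := by linarith [hu.1]
    exact_mod_cast this
  have h4 : (1 - (u : ℂ) ^ 2) ≠ 0 := by
    have := mul_ne_zero h2 h3
    intro h; apply this; linear_combination -h
  rw [cosSub]
  push_cast
  field_simp
  ring

/-- Induction on the list. In all cases of a nonempty list the new integrand is an earlier power
series times a form with poles in 0 and the fourth roots of unity. -/
theorem Plain.hasAngleRep (hL : Plain L) : HasAngleRep L := by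
  induction L with
  | nil =>
    refine hasAngleRep_of_genSum plain_nil (c := polySeq [])
      (Submodule.subset_span ⟨[], ⟨by simp, rfl⟩, rfl⟩) fun u _ => ?_
    rw [genSum, powSum, powSum, tsum_eq_single 0, tsum_eq_single 0]
    · simp [stdSeq_nil, polySeq, evenExp]
    · intro n hn; simp [polySeq, hn]
    · intro n hn; simp [stdSeq_nil, hn]
  | cons p L ih =>
    obtain ⟨l, s⟩ := p
    obtain ⟨⟨hl, hs⟩, hL'⟩ := plain_cons.1 hL
    have hrep := ih hL'
    obtain ⟨c, hc, hc'⟩ := hrep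
    rcases l with _ | _ | _
    · rcases hs.eq_or_lt with h1 | hs
      · obtain rfl : 1 = s := h1
        rw [show listWeight L + 1 = listWeight ((.even, 1) :: L) by
          rw [listWeight_cons, add_comm]] at hc
        -- The integrand is tan t · `angleInt` dt, and tan t dt = -d log cos t.
        refine hasAngleRep_of_deriv hL ((((isPrimitive_intOp_one hc).add
          (isPrimitive_intOp_neg_one hc)).add (isPrimitive_intOp_I hc).neg).add
          (isPrimitive_intOp_neg_I hc).neg)
          (add_mem (add_mem (add_mem (intOp_mem (by norm_num) hc) (intOp_mem (by norm_num) hc))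
            (neg_mem (intOp_mem Complex.I_pow_four hc)))
            (neg_mem (intOp_mem neg_I_pow_four hc))) fun u hu => ?_
        have hu' := Set.Ioo_subset_Ico_self hu
        have h2 := hL.decays
        rw [stdSeq_even_one] at h2 ⊢
        rw [genSum_evenSum hL'.decays h2 (abs_sinSub_lt_one hu')]
        simp only [Pi.add_apply, Pi.neg_apply]
        rw [inv_one_sub_add hu, mul_left_comm Complex.I, ← hc' u hu', angleInt]
        have h3 := one_add_sq_ne_zero u
        have h4 : (cosSub u : ℂ) ≠ 0 := by exact_mod_cast cosSub_ne_zero hu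
        have h5 : 1 + (cosSub u : ℂ) = 2 / (1 + (u : ℂ) ^ 2) := by
          rw [cosSub]; push_cast; field_simp; ring
        rw [eq_div_iff h3] at h5
        rw [sinSub]
        push_cast
        field_simp
        linear_combination (-2 * u * genSum (oddSum (stdSeq L)) oddExp (2 * u / (1 + u ^ 2))) * h5
      · obtain ⟨t, rfl⟩ : ∃ t, s = t + 2 := ⟨s - 2, by omega⟩
        obtain ⟨e, he, he'⟩ := exists_genSum_even hL' ⟨c, hc, hc'⟩ t
        exact hasAngleRep_of_genSum hL (convSpan_le_polySpan _ he) he'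
    · rcases hs.eq_or_lt with h1 | hs
      · obtain rfl : 1 = s := h1
        have hc0 := apply_zero_of_mem_polySpan hc
        rw [show listWeight L + 1 = listWeight ((.oddPlus, 1) :: L) by
          rw [listWeight_cons, add_comm]] at hc
        -- The integrand is `angleInt` · dt / (sin t cos t).
        refine hasAngleRep_of_deriv hL (((isPrimitive_divOp hc hc0).add
          (isPrimitive_intOp_one hc)).add (isPrimitive_intOp_neg_one hc))
          (add_mem (add_mem (convSpan_le_polySpan _ (divOp_mem hc))
            (intOp_mem (by norm_num) hc)) (intOp_mem (by norm_num) hc)) fun u hu => ?_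
        have hu' := Set.Ioo_subset_Ico_self hu
        have h2 := mul_genSum hL.decays (abs_sinSub_lt_one hu')
        rw [stdSeq_oddPlus_one] at h2 ⊢
        simp only [Pi.add_apply]
        rw [add_assoc (u : ℂ)⁻¹, inv_one_sub_add hu, mul_left_comm Complex.I, ← hc' u hu', angleInt, ← h2]
        have h3 := one_add_sq_ne_zero u
        have h4 : (cosSub u : ℂ) ≠ 0 := by exact_mod_cast cosSub_ne_zero hu
        have h6 : (u : ℂ) ≠ 0 := by exact_mod_cast hu.1.ne'
        have h5 : (cosSub u : ℂ) * (1 + (u : ℂ) ^ 2) = 1 - u ^ 2 := by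
          rw [cosSub]; push_cast; field_simp
        have h7 : (sinSub u : ℂ) = 2 * u / (1 + (u : ℂ) ^ 2) := by
          rw [sinSub]; push_cast; rfl
        rw [h7]
        push_cast
        field_simp
        linear_combination -genSum (oddSum (stdSeq L)) evenExp (sinSub u) * h5
      · obtain ⟨t, rfl⟩ : ∃ t, s = t + 2 := ⟨s - 2, by omega⟩
        obtain ⟨e, he, he'⟩ := exists_genSum_oddPlus hL' ⟨c, hc, hc'⟩ t
        have he2 := convSpan_le_polySpan _ he
        have he0 : e 0 = 0 := by
          rw [listWeight_cons, add_right_comm] at he2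
          exact apply_zero_of_mem_polySpan he2
        have he2 := convSpan_le_polySpan _ he
        -- Passing from exponents 2n+1 to 2n divides by sin t, and dt / sin t = du/u.
        refine hasAngleRep_of_deriv hL (isPrimitive_divOp he2 he0)
          (convSpan_le_polySpan _ (divOp_mem he2)) fun u hu => ?_
        have hu' := Set.Ioo_subset_Ico_self hu
        rw [mul_left_comm, ← he' u hu', ← mul_genSum hL.decays (abs_sinSub_lt_one hu')]
        have h2 := congrArg Complex.ofReal (two_div_mul_inv_sinSub hu)
        have h3 : (sinSub u : ℂ) ≠ 0 := by exact_mod_cast sinSub_ne_zero hu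
        push_cast at h2 ⊢
        rw [← h2]
        field_simp
    · exact absurd rfl hl

theorem tendsto_sinSub : Filter.Tendsto sinSub (nhdsWithin 1 (Set.Iio 1)) (nhds 1) := by
  have h := (hasDerivAt_sinSub 1).continuousAt.tendsto
  rw [show sinSub 1 = 1 by norm_num [sinSub]] at h
  exact h.mono_left nhdsWithin_le_nhds

theorem tendsto_genSum_sinSub {A : ℕ → ℝ} (k : ℕ → ℕ) {S : ℝ}
    (hS : HasSum (fun n => bCoeff n * A n) S) :
    Filter.Tendsto (fun u => genSum A k (sinSub u)) (nhdsWithin 1 (Set.Iio 1)) (nhds S) := by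
  have h1 : (S : ℂ) = ∑' n, ((bCoeff n * A n : ℝ) : ℂ) := by
    rw [← Complex.ofReal_tsum, hS.tsum_eq]
  rw [h1]
  refine tendsto_tsum_of_dominated_convergence
    (bound := fun n => ‖bCoeff n * A n‖) hS.summable.norm (fun n => ?_) ?_
  · have h2 := ((Complex.continuous_ofReal.tendsto 1).comp tendsto_sinSub).pow (k n)
    simpa using h2.const_mul ((bCoeff n * A n : ℝ) : ℂ)
  · filter_upwards [Ioo_mem_nhdsLT (show (0 : ℝ) < 1 from one_pos)] with u hu n
    rw [norm_mul, norm_pow, Complex.norm_real, Complex.norm_real, Real.norm_eq_abs (sinSub u)]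
    exact mul_le_of_le_one_right (norm_nonneg _) (pow_le_one₀ (abs_nonneg _)
      (abs_sinSub_lt_one (Set.Ioo_subset_Ico_self hu)).le)

/-- Both sides are let tend to u = 1: dominated convergence in sin t on the left, Abel's theorem in
u on the right. -/
theorem eq_mul_of_genSum_eq {A : ℕ → ℝ} {k : ℕ → ℕ} {S : ℝ}
    (hS : HasSum (fun n => bCoeff n * A n) S) {w : ℕ} {c : ℕ → ℂ} (hc : c ∈ convSpan w) {θ : ℂ}
    (h : ∀ u ∈ Set.Ico (0 : ℝ) 1, genSum A k (sinSub u) = θ * powSum c id u) :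
    ∃ v ∈ CMZV 4 w, (S : ℂ) = θ * v := by
  obtain ⟨v, hv, ht⟩ := exists_mem_CMZV_tendsto hc
  refine ⟨v, hv, tendsto_nhds_unique (tendsto_genSum_sinSub k hS) ?_⟩
  have h1 := (Complex.tendsto_tsum_powerSeries_nhdsWithin_lt ht)
  rw [Filter.tendsto_map'_iff] at h1
  refine (h1.const_mul θ).congr' ?_
  filter_upwards [Ioo_mem_nhdsLT (show (0 : ℝ) < 1 from one_pos)] with u hu
  exact (h u (Set.Ioo_subset_Ico_self hu)).symm

/-- The value of a convergent standard series. -/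
theorem Plain.exists_hasSum {l : LinForm} {s : ℕ} (hL : Plain ((l, s) :: L)) (hs : 2 ≤ s) :
    ∃ S : ℝ, HasSum (fun n => bCoeff n * stdSeq ((l, s) :: L) n) S ∧
      ∃ v ∈ CMZV 4 (listWeight ((l, s) :: L)), (S : ℂ) = Complex.I ^ l.delta * v := by
  obtain ⟨⟨hl, -⟩, hL'⟩ := plain_cons.1 hL
  have hsum : Summable fun n => bCoeff n * stdSeq ((l, s) :: L) n :=
    summable_bCoeff_mul (by exact_mod_cast l.decays_recip_pow hs) hL'.decays l.sign.below_subset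
  refine ⟨_, hsum.hasSum, ?_⟩
  obtain ⟨t, rfl⟩ : ∃ t, s = t + 2 := ⟨s - 2, by omega⟩
  rcases l with _ | _ | _
  · obtain ⟨c, hc, h⟩ := exists_genSum_even hL' hL'.hasAngleRep t
    exact eq_mul_of_genSum_eq hsum.hasSum hc (k := evenExp) (by simpa [LinForm.delta] using h)
  · obtain ⟨c, hc, h⟩ := exists_genSum_oddPlus hL' hL'.hasAngleRep t
    exact eq_mul_of_genSum_eq hsum.hasSum hc (k := oddExp) (by simpa [LinForm.delta] using h)
  · exact absurd rfl hl

end Standard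

/-! ### Reducing arbitrary forms and signs to standard sums -/

section Reduction

/-- The sums `∑_{n ≻ m} A_m`, as a linear map. -/
noncomputable def prefixSum (r : IneqSign) : (ℕ → ℝ) →ₗ[ℚ] (ℕ → ℝ) where
  toFun A n := ∑ m ∈ r.below n, A m
  map_add' A B := by ext n; simp [sum_add_distrib]
  map_smul' q A := by ext n; simp [smul_sum]

theorem prefixSum_apply (r : IneqSign) (A : ℕ → ℝ) (n : ℕ) :
    prefixSum r A n = ∑ m ∈ r.below n, A m := rfl

theorem prefixSum_gt_zero (A : ℕ → ℝ) : prefixSum .gt A 0 = 0 := rfl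

theorem prefixSum_gt_succ (A : ℕ → ℝ) (n : ℕ) : prefixSum .gt A (n + 1) = prefixSum .ge A n := rfl

theorem prefixSum_ge (A : ℕ → ℝ) : prefixSum .ge A = prefixSum .gt A + A := by
  ext n
  exact sum_range_succ A n

theorem stdSeq_cons_eq (l : LinForm) (s : ℕ) (L : List (LinForm × ℕ)) :
    stdSeq ((l, s) :: L) = l.recip ^ s * prefixSum l.sign (stdSeq L) := rfl

theorem LinForm.recip_oddMinus_succ (n : ℕ) :
    LinForm.oddMinus.recip (n + 1) = LinForm.oddPlus.recip n := by
  rw [recip_oddMinus, recip_oddPlus]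
  push_cast
  ring

/-- Shift the index by one; the term at 0 drops out because its inner sum is empty. -/
theorem prefixSum_ge_oddMinus (s : ℕ) (A : ℕ → ℝ) :
    prefixSum .ge (LinForm.oddMinus.recip ^ s * prefixSum .gt A) =
      prefixSum .gt (LinForm.oddPlus.recip ^ s * prefixSum .ge A) := by
  ext n
  simp only [prefixSum_apply, IneqSign.below]
  rw [sum_range_succ']
  simp only [Pi.mul_apply, Pi.pow_apply, prefixSum_gt_zero, mul_zero, add_zero,
    LinForm.recip_oddMinus_succ, prefixSum_gt_succ]

/-- Partial fractions, as the forms differ by constants. The term at 0 corrects for the value 0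
given to the reciprocal of 2n at n = 0. -/
theorem exists_recip_mul_recip {l l' : LinForm} (h : l ≠ l') : ∃ c c₀ : ℚ,
    l.recip * l'.recip = c • (l.recip - l'.recip) + c₀ • (Pi.single 0 1 : ℕ → ℝ) := by
  have key : ∀ {l l' : LinForm} (c c₀ : ℚ), (l.recip 0 * l'.recip 0 =
      c * (l.recip 0 - l'.recip 0) + c₀) → (∀ n : ℕ, l.recip (n + 1) * l'.recip (n + 1) =
      c * (l.recip (n + 1) - l'.recip (n + 1))) →
      l.recip * l'.recip = c • (l.recip - l'.recip) + c₀ • (Pi.single 0 1 : ℕ → ℝ) := by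
    intro l l' c c₀ h0 hn
    ext n
    rcases n with _ | n
    · simp [h0, Rat.smul_def]
    · simp [hn, Rat.smul_def]
  have h1 : ∀ n : ℕ, (2 * (n + 1) : ℝ) ≠ 0 := fun n => by positivity
  have h2 : ∀ n : ℕ, (2 * (n + 1) + 1 : ℝ) ≠ 0 := fun n => by positivity
  have h3 : ∀ n : ℕ, (2 * (n + 1) - 1 : ℝ) ≠ 0 := fun n => by
    have : (0 : ℝ) ≤ n := n.cast_nonneg
    linarith
  have h12 : ∃ c c₀ : ℚ, LinForm.even.recip * LinForm.oddPlus.recip =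
      c • (LinForm.even.recip - LinForm.oddPlus.recip) + c₀ • (Pi.single 0 1 : ℕ → ℝ) := by
    refine ⟨1, 1, key 1 1 (by simp [LinForm.recip_even, LinForm.recip_oddPlus]) fun n => ?_⟩
    have := h1 n
    have := h2 n
    simp only [LinForm.recip_even, LinForm.recip_oddPlus]
    push_cast
    field_simp
    ring
  have h13 : ∃ c c₀ : ℚ, LinForm.even.recip * LinForm.oddMinus.recip =
      c • (LinForm.even.recip - LinForm.oddMinus.recip) + c₀ • (Pi.single 0 1 : ℕ → ℝ) := by
    refine ⟨-1, 1, key _ _ (by norm_num [LinForm.recip_even, LinForm.recip_oddMinus]) fun n => ?_⟩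
    have := h1 n
    have := h3 n
    simp only [LinForm.recip_even, LinForm.recip_oddMinus]
    push_cast
    field_simp
    ring
  have h23 : ∃ c c₀ : ℚ, LinForm.oddPlus.recip * LinForm.oddMinus.recip =
      c • (LinForm.oddPlus.recip - LinForm.oddMinus.recip) + c₀ • (Pi.single 0 1 : ℕ → ℝ) := by
    refine ⟨-1 / 2, 0, key _ _ (by norm_num [LinForm.recip_oddPlus, LinForm.recip_oddMinus])
      fun n => ?_⟩
    have := h2 n
    have := h3 n
    simp only [LinForm.recip_oddPlus, LinForm.recip_oddMinus]
    push_cast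
    field_simp
    ring
  have symm : ∀ {l l' : LinForm}, (∃ c c₀ : ℚ, l.recip * l'.recip =
      c • (l.recip - l'.recip) + c₀ • (Pi.single 0 1 : ℕ → ℝ)) → ∃ c c₀ : ℚ, l'.recip * l.recip =
      c • (l'.recip - l.recip) + c₀ • (Pi.single 0 1 : ℕ → ℝ) := by
    rintro l l' ⟨c, c₀, h⟩
    exact ⟨-c, c₀, by rw [mul_comm, h]; module⟩
  rcases l with _ | _ | _ <;> rcases l' with _ | _ | _ <;>
    first
      | exact absurd rfl h
      | exact h12
      | exact h13
      | exact h23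
      | exact symm h12
      | exact symm h13
      | exact symm h23

theorem LinForm.exists_recip_zero_eq (l : LinForm) : ∃ q : ℚ, l.recip 0 = q :=
  ⟨(l.eval 0 : ℚ)⁻¹, by simp [LinForm.recip]⟩

theorem single_mul_eq {A : ℕ → ℝ} {q : ℚ} (hA : A 0 = q) :
    (Pi.single 0 1 : ℕ → ℝ) * A = q • (Pi.single 0 1 : ℕ → ℝ) := by
  ext n
  rcases n with _ | n <;> simp [hA, Rat.smul_def]

/-- Partial fractions, modulo a space of sequences. -/
theorem recip_pow_mul_mem {T : Submodule ℚ (ℕ → ℝ)} (hT : Pi.single 0 1 ∈ T) {l l' : LinForm}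
    (hl : l ≠ l') {Y : ℕ → ℝ} {q : ℚ} (hY : Y 0 = q) (h11 : l.recip * l'.recip * Y ∈ T) {a b : ℕ}
    (ha : ∀ k, 2 ≤ k → k ≤ a → l.recip ^ k * Y ∈ T)
    (hb : ∀ k, 2 ≤ k → k ≤ b → l'.recip ^ k * Y ∈ T) (N : ℕ) :
    ∀ i j, i + j ≤ N → i + 1 ≤ a → j + 1 ≤ b →
      l.recip ^ (i + 1) * l'.recip ^ (j + 1) * Y ∈ T := by
  obtain ⟨c, c₀, hc⟩ := exists_recip_mul_recip hl
  obtain ⟨p, hp⟩ := l.exists_recip_zero_eq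
  obtain ⟨p', hp'⟩ := l'.exists_recip_zero_eq
  -- One partial fraction lowers one of the two exponents. The correction at n = 0 is a rational
  -- multiple of `Pi.single 0 1`, hence the rationality of `Y 0`.
  have step : ∀ i j, l.recip ^ (i + 1) * l'.recip ^ j * Y ∈ T →
      l.recip ^ i * l'.recip ^ (j + 1) * Y ∈ T →
      l.recip ^ (i + 1) * l'.recip ^ (j + 1) * Y ∈ T := by
    intro i j h1 h2
    have h3 : l.recip ^ (i + 1) * l'.recip ^ (j + 1) * Y =
        c • (l.recip ^ (i + 1) * l'.recip ^ j * Y - l.recip ^ i * l'.recip ^ (j + 1) * Y) +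
        c₀ • ((Pi.single 0 1 : ℕ → ℝ) * (l.recip ^ i * l'.recip ^ j * Y)) := by
      calc l.recip ^ (i + 1) * l'.recip ^ (j + 1) * Y =
            (l.recip * l'.recip) * (l.recip ^ i * l'.recip ^ j * Y) := by ring
        _ = _ := by
          rw [hc, add_mul, smul_mul_assoc, smul_mul_assoc]
          congr 2
          ring
    have h4 : (l.recip ^ i * l'.recip ^ j * Y) 0 = ((p ^ i * p' ^ j * q : ℚ) : ℝ) := by
      simp [hp, hp', hY]
    rw [h3, single_mul_eq h4]
    exact add_mem (T.smul_mem _ (sub_mem h1 h2)) (T.smul_mem _ (T.smul_mem _ hT))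
  induction N with
  | zero =>
    intro i j hij _ _
    obtain ⟨rfl, rfl⟩ : i = 0 ∧ j = 0 := by omega
    simpa using h11
  | succ N ih =>
    intro i j hij hi hj
    rcases i with _ | i <;> rcases j with _ | j
    · simpa using h11
    · exact step _ _ (ih 0 j (by omega) hi (by omega))
        (by simpa using hb (j + 1 + 1) (by omega) hj)
    · exact step _ _ (by simpa using ha (i + 1 + 1) (by omega) hi)
        (ih i 0 (by omega) (by omega) hj)
    · exact step _ _ (ih (i + 1) j (by omega) hi (by omega)) (ih i (j + 1) (by omega) (by omega) hj)

/-- A filtered space of sequences that contains the nested sums whose inner part is standard,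
with outermost exponent at least `1 + e`. -/
structure IsTarget (e : ℕ) (T : ℕ → Submodule ℚ (ℕ → ℝ)) : Prop where
  le_one : e ≤ 1
  mono : Monotone T
  single_mem : Pi.single 0 1 ∈ T 0
  std_mem : ∀ {l : LinForm} {s : ℕ} {L : List (LinForm × ℕ)}, Plain L → 1 + e ≤ s →
    stdSeq ((l, s) :: L) ∈ T (listWeight L + s + e * l.nu)
  prod_mem : ∀ {L : List (LinForm × ℕ)}, Plain L →
    LinForm.oddPlus.recip * stdSeq L ∈ T (listWeight L + 1) → ∀ {l l' : LinForm}, l ≠ l' →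
    l.recip * l'.recip * prefixSum .gt (stdSeq L) ∈ T (listWeight L + 2)

variable {e : ℕ} {T : ℕ → Submodule ℚ (ℕ → ℝ)} {L : List (LinForm × ℕ)}

theorem LinForm.nu_le_one (l : LinForm) : l.nu ≤ 1 := by cases l <;> simp [nu]

theorem IsTarget.mul_nu_le (hT : IsTarget e T) (l : LinForm) : e * l.nu ≤ 1 :=
  Nat.mul_le_mul hT.le_one l.nu_le_one

theorem Plain.exists_stdSeq_zero_eq (hL : Plain L) : ∃ q : ℚ, stdSeq L 0 = q := by
  induction L with
  | nil => exact ⟨1, by simp [stdSeq_nil]⟩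
  | cons p L ih =>
    obtain ⟨l, s⟩ := p
    obtain ⟨⟨hl, hs⟩, hL'⟩ := plain_cons.1 hL
    obtain ⟨q, hq⟩ := ih hL'
    rcases l with _ | _ | _
    · exact ⟨0, by simp [stdSeq_even_zero]⟩
    · exact ⟨q, by simp [stdSeq_cons, LinForm.recip_oddPlus, LinForm.sign, IneqSign.below, hq]⟩
    · exact absurd rfl hl

/-- Closure of `T` under multiplying a standard sequence by powers of the reciprocals. -/
def MulMem (e : ℕ) (T : ℕ → Submodule ℚ (ℕ → ℝ)) (L : List (LinForm × ℕ)) : Prop :=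
  ∀ (l : LinForm) (s : ℕ), 1 ≤ s → l.recip ^ s * stdSeq L ∈ T (listWeight L + s + e * l.nu)

theorem IsTarget.prefixSum_gt_mem (hT : IsTarget e T) (hL : Plain L) (h : MulMem e T L)
    (l : LinForm) {s : ℕ} (hs : 1 + e ≤ s) :
    l.recip ^ s * prefixSum .gt (stdSeq L) ∈ T (listWeight L + s + e * l.nu) := by
  have h1 := hT.std_mem (l := l) hL hs
  rw [stdSeq_cons_eq] at h1
  rcases l with _ | _ | _
  · exact h1
  · have h2 := sub_mem h1 (h .oddPlus s (by omega))
    have h3 : LinForm.oddPlus.sign = .ge := rfl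
    rwa [h3, prefixSum_ge, mul_add, add_sub_cancel_right] at h2
  · exact h1

theorem IsTarget.mul_mul_stdSeq_mem (hT : IsTarget e T) (hL : Plain L) (h : MulMem e T L)
    {l l' : LinForm} (hl : l ≠ l') {a b : ℕ} (ha : 1 ≤ a) (hb : 1 ≤ b) :
    l.recip ^ a * l'.recip ^ b * stdSeq L ∈ T (listWeight L + a + b) := by
  obtain ⟨q, hq⟩ := hL.exists_stdSeq_zero_eq
  have h1 := hT.mul_nu_le l
  have h2 := hT.mul_nu_le l'
  have hsingle : Pi.single 0 1 ∈ T (listWeight L + a + b) := hT.mono (Nat.zero_le _) hT.single_mem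
  have ha' : ∀ k, 1 ≤ k → k ≤ a → l.recip ^ k * stdSeq L ∈ T (listWeight L + a + b) :=
    fun k hk hka => hT.mono (by omega) (h l k hk)
  have hb' : ∀ k, 1 ≤ k → k ≤ b → l'.recip ^ k * stdSeq L ∈ T (listWeight L + a + b) :=
    fun k hk hkb => hT.mono (by omega) (h l' k hk)
  have h11 : l.recip * l'.recip * stdSeq L ∈ T (listWeight L + a + b) := by
    obtain ⟨c, c₀, hc⟩ := exists_recip_mul_recip hl
    rw [hc, add_mul, smul_mul_assoc, smul_mul_assoc, single_mul_eq hq, sub_mul]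
    exact add_mem (Submodule.smul_mem _ _ (sub_mem (by simpa using ha' 1 le_rfl ha)
      (by simpa using hb' 1 le_rfl hb))) (Submodule.smul_mem _ _ (Submodule.smul_mem _ _ hsingle))
  obtain ⟨i, rfl⟩ : ∃ i, a = i + 1 := ⟨a - 1, by omega⟩
  obtain ⟨j, rfl⟩ : ∃ j, b = j + 1 := ⟨b - 1, by omega⟩
  exact recip_pow_mul_mem hsingle hl hq h11 (fun k hk => ha' k (by omega))
    (fun k hk => hb' k (by omega)) (i + j) i j le_rfl le_rfl le_rfl

/-- Partial fractions lose one unit of weight, which pays for the extra weight `e * l.nu` of a pure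
power; so none appears in the conclusion. -/
theorem IsTarget.mul_mul_prefixSum_mem (hT : IsTarget e T) (hL : Plain L) (h : MulMem e T L)
    {l l' : LinForm} (hl : l ≠ l') {a b : ℕ} (ha : 1 ≤ a) (hb : 1 ≤ b) (r : IneqSign) :
    l.recip ^ a * l'.recip ^ b * prefixSum r (stdSeq L) ∈ T (listWeight L + a + b) := by
  have h1 := hT.mul_nu_le l
  have h2 := hT.mul_nu_le l'
  have he := hT.le_one
  have gt : l.recip ^ a * l'.recip ^ b * prefixSum .gt (stdSeq L) ∈ T (listWeight L + a + b) := by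
    have h11 : l.recip * l'.recip * prefixSum .gt (stdSeq L) ∈ T (listWeight L + a + b) :=
      hT.mono (by omega) (hT.prod_mem hL (by simpa [LinForm.nu] using h .oddPlus 1 le_rfl) hl)
    obtain ⟨i, rfl⟩ : ∃ i, a = i + 1 := ⟨a - 1, by omega⟩
    obtain ⟨j, rfl⟩ : ∃ j, b = j + 1 := ⟨b - 1, by omega⟩
    exact recip_pow_mul_mem (hT.mono (Nat.zero_le _) hT.single_mem) hl (q := 0)
      (by simp [prefixSum_gt_zero]) h11
      (fun k hk hka => hT.mono (by omega) (hT.prefixSum_gt_mem hL h l (s := k) (by omega)))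
      (fun k hk hkb => hT.mono (by omega) (hT.prefixSum_gt_mem hL h l' (s := k) (by omega)))
      (i + j) i j le_rfl le_rfl le_rfl
  cases r
  · exact gt
  · rw [prefixSum_ge, mul_add]
    exact add_mem gt (hT.mul_mul_stdSeq_mem hL h hl ha hb)

/-- If the forms agree, the exponents add up to at least 2 and the sequence is standard inside;
otherwise partial fractions reduce to the tail, covered by induction. -/
theorem IsTarget.mulMem (hT : IsTarget e T) (hL : Plain L) : MulMem e T L := by
  induction L with
  | nil =>
    intro l s hs
    obtain ⟨p, hp⟩ := l.exists_recip_zero_eq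
    rw [stdSeq_nil, mul_comm (l.recip ^ s), single_mul_eq (q := p ^ s) (by simp [hp])]
    exact Submodule.smul_mem _ _ (hT.mono (Nat.zero_le _) hT.single_mem)
  | cons p L ih =>
    obtain ⟨l', t⟩ := p
    obtain ⟨⟨hl, ht⟩, hL'⟩ := plain_cons.1 hL
    intro l s hs
    have he := hT.le_one
    rw [listWeight_cons]
    by_cases h : l = l'
    · subst h
      have h1 : l.recip ^ s * stdSeq ((l, t) :: L) = stdSeq ((l, s + t) :: L) := by
        rw [stdSeq_cons_eq, stdSeq_cons_eq, pow_add, mul_assoc]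
      rw [h1]
      exact hT.mono (by omega) (hT.std_mem (l := l) (s := s + t) hL' (by omega))
    · rw [stdSeq_cons_eq, ← mul_assoc]
      exact hT.mono (by omega) (hT.mul_mul_prefixSum_mem hL' (ih hL') h hs ht _)

/-- The span of the nested sums of weight at most `w` whose inner part is standard. -/
noncomputable def nearStdSpan (w : ℕ) : Submodule ℚ (ℕ → ℝ) :=
  Submodule.span ℚ (stdSeq '' {L | listWeight L ≤ w ∧ (∀ p ∈ L, 1 ≤ p.2) ∧ Plain L.tail})

theorem nearStdSpan_mono : Monotone nearStdSpan := fun _ _ h =>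
  Submodule.span_mono (Set.image_mono fun _ hL => ⟨hL.1.trans h, hL.2⟩)

theorem stdSeq_mem_nearStdSpan (l : LinForm) {s w : ℕ} (hL : Plain L) (hs : 1 ≤ s)
    (hw : s + listWeight L ≤ w) : stdSeq ((l, s) :: L) ∈ nearStdSpan w := by
  refine Submodule.subset_span ⟨(l, s) :: L, ⟨by rwa [listWeight_cons], ?_, hL⟩, rfl⟩
  simp only [List.mem_cons, forall_eq_or_imp]
  exact ⟨hs, fun p hp => (hL p hp).2⟩

/-- With `e = 0` first powers are allowed, so a product of two reciprocals simply splits. This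
instance handles the inner indices. -/
theorem isTarget_nearStdSpan : IsTarget 0 nearStdSpan where
  le_one := zero_le_one
  mono := nearStdSpan_mono
  single_mem := Submodule.subset_span ⟨[], ⟨le_rfl, by simp, plain_nil⟩, rfl⟩
  std_mem hL hs := stdSeq_mem_nearStdSpan _ hL hs (by omega)
  prod_mem {L} hL h l l' hl := by
    have hmem : ∀ l : LinForm, l.recip * prefixSum .gt (stdSeq L) ∈
        nearStdSpan (listWeight L + 2) := by
      intro l
      have h1 := stdSeq_mem_nearStdSpan l (w := listWeight L + 2) hL le_rfl (by omega)
      rw [stdSeq_cons_eq, pow_one] at h1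
      rcases l with _ | _ | _
      · exact h1
      · have h2 := sub_mem h1 (nearStdSpan_mono (Nat.le_succ _) h)
        have h3 : LinForm.oddPlus.sign = .ge := rfl
        rwa [h3, prefixSum_ge, mul_add, add_sub_cancel_right] at h2
      · exact h1
    obtain ⟨c, c₀, hc⟩ := exists_recip_mul_recip hl
    rw [hc, add_mul, smul_mul_assoc, smul_mul_assoc, single_mul_eq (q := 0)
      (by simp [prefixSum_gt_zero]), sub_mul, zero_smul, smul_zero, add_zero]
    exact Submodule.smul_mem _ _ (sub_mem (hmem l) (hmem l'))

/-- The inductive step of the reduction: a new index with any form and sign is put in front of a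
sequence with at most one 2n - 1, standing first. -/
theorem IsTarget.mul_prefixSum_mem (hT : IsTarget e T) {w : ℕ} {A : ℕ → ℝ}
    (hA : A ∈ nearStdSpan w) (l : LinForm) {s : ℕ} (hs : 1 + e ≤ s) (r : IneqSign) :
    l.recip ^ s * prefixSum r A ∈ T (w + s + e * l.nu) := by
  have he := hT.le_one
  induction hA using Submodule.span_induction with
  | zero => simp
  | add A B _ _ hA hB => rw [map_add, mul_add]; exact add_mem hA hB
  | smul q A _ hA => rw [map_smul, mul_smul_comm]; exact Submodule.smul_mem _ _ hA
  | mem A hA =>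
    obtain ⟨L, ⟨hw, hpos, htail⟩, rfl⟩ := hA
    have plain : ∀ {L}, listWeight L ≤ w → Plain L → ∀ r,
        l.recip ^ s * prefixSum r (stdSeq L) ∈ T (w + s + e * l.nu) := by
      intro L hw hL r
      have h1 := hT.prefixSum_gt_mem hL (hT.mulMem hL) l hs
      refine hT.mono (Nat.add_le_add_right (Nat.add_le_add_right hw s) _) ?_
      cases r
      · exact h1
      · rw [prefixSum_ge, mul_add]
        exact add_mem h1 (hT.mulMem hL l s (by omega))
    rcases L with _ | ⟨⟨l', t⟩, L⟩
    · exact plain hw plain_nil r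
    have ht : 1 ≤ t := hpos (l', t) (by simp)
    rw [listWeight_cons] at hw
    rw [List.tail_cons] at htail
    by_cases hl' : l' = .oddMinus
    · subst hl'
      -- Under ≥ the leading 2n - 1 shifts to 2n + 1. The sign > differs by the diagonal term, where
      -- the two forms share an index.
      have hge : l.recip ^ s * prefixSum .ge (stdSeq ((.oddMinus, t) :: L)) ∈
          T (w + s + e * l.nu) := by
        rw [stdSeq_cons_eq]
        simp only [LinForm.sign]
        rw [prefixSum_ge_oddMinus]
        exact plain (L := (.oddPlus, t) :: L) (by rwa [listWeight_cons])
          (plain_oddPlus ht htail) .gt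
      cases r
      · have hself : l.recip ^ s * stdSeq ((.oddMinus, t) :: L) ∈ T (w + s + e * l.nu) := by
          by_cases hl : l = .oddMinus
          · subst hl
            have h1 : LinForm.oddMinus.recip ^ s * stdSeq ((.oddMinus, t) :: L) =
                stdSeq ((.oddMinus, s + t) :: L) := by
              rw [stdSeq_cons_eq, stdSeq_cons_eq, pow_add, mul_assoc]
            rw [h1]
            refine hT.mono ?_ (hT.std_mem (l := .oddMinus) (s := s + t) htail (by omega))
            exact Nat.add_le_add_right (by omega) _
          · rw [stdSeq_cons_eq, ← mul_assoc]
            refine hT.mono ?_ (hT.mul_mul_prefixSum_mem htail (hT.mulMem htail) hl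
              (by omega : 1 ≤ s) ht _)
            omega
        have h2 := sub_mem hge hself
        rwa [prefixSum_ge, mul_add, add_sub_cancel_right] at h2
      · exact hge
    · exact plain (L := (l', t) :: L) (by rwa [listWeight_cons])
        (plain_cons.2 ⟨⟨hl', ht⟩, htail⟩) r

theorem chainSeq_formChain_cons (l : LinForm) (r : IneqSign) (s : ℕ)
    (R : List (LinForm × IneqSign × ℕ)) :
    chainSeq (formChain ((l, r, s) :: R)) = l.recip ^ s * prefixSum r (chainSeq (formChain R)) :=
  rfl

theorem chainSeq_mem_nearStdSpan {R : List (LinForm × IneqSign × ℕ)} (hR : ∀ p ∈ R, 1 ≤ p.2.2) :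
    chainSeq (formChain R) ∈ nearStdSpan (R.map fun p => p.2.2).sum := by
  induction R with
  | nil => exact isTarget_nearStdSpan.single_mem
  | cons p R ih =>
    obtain ⟨l, r, s⟩ := p
    rw [chainSeq_formChain_cons]
    have h1 := isTarget_nearStdSpan.mul_prefixSum_mem (ih fun q hq => hR q (by simp [hq])) l
      (s := s) (hR (l, r, s) (by simp)) r
    rw [zero_mul, add_zero, add_comm] at h1
    simpa using h1

end Reduction

/-! ### Values of weight at most w over ℚ[i] -/

section Values

theorem isCMZV_one (N : ℕ) : IsCMZV N 0 1 := by
  classical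
  refine ⟨0, Fin.elim0, Fin.elim0, fun j => j.elim0, fun j => j.elim0, by simp,
    fun h => absurd h (lt_irrefl 0), ?_⟩
  refine tendsto_const_nhds.congr fun M => ?_
  simp [polylogPartialSum, Subsingleton.strictAnti]

theorem CMZVLeGaussian_mono (N : ℕ) : Monotone (CMZVLeGaussian N) := fun _ _ h =>
  Submodule.span_mono fun _ ⟨k, hk, hv⟩ => ⟨k, hk.trans h, hv⟩

theorem rat_smul_mem_CMZVLeGaussian {N w : ℕ} {v : ℂ} (q : ℚ) (hv : v ∈ CMZVLeGaussian N w) :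
    q • v ∈ CMZVLeGaussian N w := by
  rw [← algebraMap_smul (Algebra.adjoin ℚ {Complex.I}) q v]
  exact Submodule.smul_mem _ _ hv

theorem mem_CMZVLeGaussian_of_mem_CMZV {N k w : ℕ} (hk : k ≤ w) {v : ℂ} (hv : v ∈ CMZV N k) :
    v ∈ CMZVLeGaussian N w := by
  induction hv using Submodule.span_induction with
  | mem v hv => exact Submodule.subset_span ⟨k, hk, hv⟩
  | zero => exact zero_mem _
  | add v v' _ _ h h' => exact add_mem h h'
  | smul q v _ h => exact rat_smul_mem_CMZVLeGaussian q h

theorem I_pow_mul_mem_CMZVLeGaussian {N w : ℕ} {v : ℂ} (hv : v ∈ CMZVLeGaussian N w) (k : ℕ) :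
    Complex.I ^ k * v ∈ CMZVLeGaussian N w := by
  have hI : Complex.I ^ k ∈ Algebra.adjoin ℚ {Complex.I} :=
    pow_mem (Algebra.subset_adjoin (Set.mem_singleton _)) k
  have h := Submodule.smul_mem (CMZVLeGaussian N w) ⟨_, hI⟩ hv
  rwa [Subalgebra.smul_def, smul_eq_mul] at h

/-- The sequences `A` for which `∑ b_n A_n` converges to an element of `CMZV_{≤ w}^4 ⊗ ℚ[i]`. -/
noncomputable def gaussianValued (w : ℕ) : Submodule ℚ (ℕ → ℝ) where
  carrier := {A | ∃ S : ℝ, HasSum (fun n => bCoeff n * A n) S ∧ (S : ℂ) ∈ CMZVLeGaussian 4 w}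
  zero_mem' := ⟨0, by simp, by simp⟩
  add_mem' := by
    rintro A B ⟨S, hS, hS'⟩ ⟨S', hS2, hS2'⟩
    exact ⟨S + S', by simpa [mul_add] using hS.add hS2, by
      rw [Complex.ofReal_add]; exact add_mem hS' hS2'⟩
  smul_mem' := by
    rintro q A ⟨S, hS, hS'⟩
    refine ⟨q * S, ?_, ?_⟩
    · simpa [Rat.smul_def, mul_left_comm] using hS.mul_left (q : ℝ)
    · have := rat_smul_mem_CMZVLeGaussian q hS'
      rw [Rat.smul_def] at this
      exact_mod_cast this

variable {L : List (LinForm × ℕ)}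

theorem Plain.stdSeq_mem_gaussianValued {l : LinForm} {s : ℕ} (hL : Plain ((l, s) :: L))
    (hs : 2 ≤ s) : stdSeq ((l, s) :: L) ∈ gaussianValued (listWeight L + s) := by
  obtain ⟨S, hS, v, hv, h⟩ := hL.exists_hasSum hs
  refine ⟨S, hS, ?_⟩
  rw [h]
  rw [listWeight_cons, add_comm] at hv
  exact I_pow_mul_mem_CMZVLeGaussian (mem_CMZVLeGaussian_of_mem_CMZV le_rfl hv) _

theorem HasSum.of_shift {f g : ℕ → ℝ} {S : ℝ} (hg : HasSum g S) (h0 : f 0 = 0)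
    (h : ∀ n, f (n + 1) = g n) : HasSum f S := by
  rw [← hasSum_nat_add_iff' 1]
  simpa [h0, h] using hg

/-- Shifting the index of summation turns `2n - 1` into `2n + 1`. -/
theorem hasSum_oddMinus {A : ℕ → ℝ} {s : ℕ} {S S' : ℝ}
    (hS : HasSum (fun n => bCoeff n * (LinForm.oddPlus.recip ^ s * prefixSum .ge A) n) S)
    (hS' : HasSum (fun n => bCoeff n * (LinForm.oddPlus.recip ^ (s + 1) * prefixSum .ge A) n) S') :
    HasSum (fun n => bCoeff n * (LinForm.oddMinus.recip ^ s * prefixSum .gt A) n) (S + S') := by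
  refine (hS.add hS').of_shift (by simp [prefixSum_gt_zero]) fun n => ?_
  simp only [Pi.mul_apply, Pi.pow_apply, LinForm.recip_oddMinus_succ, prefixSum_gt_succ,
    bCoeff_succ', pow_succ]
  ring

theorem stdSeq_oddMinus_mem (hL : Plain L) {s : ℕ} (hs : 2 ≤ s) :
    stdSeq ((.oddMinus, s) :: L) ∈ gaussianValued (listWeight L + s + 1) := by
  obtain ⟨S, hS, h⟩ := (plain_oddPlus (by omega) hL).stdSeq_mem_gaussianValued hs
  obtain ⟨S', hS', h'⟩ := (plain_oddPlus (by omega) hL).stdSeq_mem_gaussianValued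
    (show 2 ≤ s + 1 by omega)
  refine ⟨_, hasSum_oddMinus hS hS', ?_⟩
  rw [Complex.ofReal_add]
  exact add_mem (CMZVLeGaussian_mono 4 (Nat.le_succ _) h) h'

/-- The shift turns b_n / (2n (2n-1)) into b_n / (2n+1)², a standard outer factor. -/
theorem even_mul_oddMinus_mem (hL : Plain L) :
    LinForm.even.recip * LinForm.oddMinus.recip * prefixSum .gt (stdSeq L) ∈
      gaussianValued (listWeight L + 2) := by
  obtain ⟨S, hS, h⟩ := (plain_oddPlus one_le_two hL).stdSeq_mem_gaussianValued le_rfl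
  refine ⟨S, hS.of_shift (by simp [prefixSum_gt_zero]) fun n => ?_, h⟩
  rw [stdSeq_cons_eq]
  simp only [Pi.mul_apply, Pi.pow_apply, LinForm.recip_oddMinus_succ, prefixSum_gt_succ]
  rw [← mul_assoc, ← mul_assoc, bCoeff_succ_mul_recip, LinForm.sign]
  ring

/-- Splitting 1/(2n(2n+1)) alone would give first powers, whose series need not converge. The
difference from the right-hand series telescopes instead. -/
theorem hasSum_even_mul_oddPlus (hL : Plain L) {S : ℝ}
    (hS : HasSum (fun n => bCoeff n * (LinForm.oddPlus.recip * stdSeq L) n) S) :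
    HasSum (fun n => bCoeff n *
      (LinForm.even.recip * LinForm.oddPlus.recip * prefixSum .gt (stdSeq L)) n) S := by
  have hsum : Summable fun n => bCoeff n *
      (LinForm.even.recip * LinForm.oddPlus.recip * prefixSum .gt (stdSeq L)) n := by
    have h1 : Decays 2 fun n => LinForm.even.recip n * LinForm.oddPlus.recip n := by
      have := (LinForm.even.decays_recip_pow (le_refl 1)).mul
        (LinForm.oddPlus.decays_recip_pow (le_refl 1))
      norm_num at this
      exact this
    exact (summable_bCoeff_mul h1 hL.decays (IneqSign.below_subset .gt)).congr fun n => rfl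
  -- Telescoping by b_{n+1}/(2n+2) = b_n/(2n+1); the boundary term decays like N^{-1/4}.
  have key : ∀ N, ∑ n ∈ range (N + 1), (bCoeff n *
      (LinForm.even.recip * LinForm.oddPlus.recip * prefixSum .gt (stdSeq L)) n -
      bCoeff n * (LinForm.oddPlus.recip * stdSeq L) n) =
      -(bCoeff N * oddSum (stdSeq L) N) := by
    intro N
    induction N with
    | zero => simp [prefixSum_gt_zero, oddSum]
    | succ N ih =>
      rw [sum_range_succ, ih]
      have h1 : bCoeff (N + 1) * LinForm.even.recip (N + 1) * prefixSum .ge (stdSeq L) N =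
          bCoeff N * oddSum (stdSeq L) N := by
        rw [bCoeff_succ_mul_recip, oddSum, mul_assoc]
        rfl
      have h2 : LinForm.even.recip (N + 1) * LinForm.oddPlus.recip (N + 1) =
          LinForm.even.recip (N + 1) - LinForm.oddPlus.recip (N + 1) := by
        rw [LinForm.recip_even, LinForm.recip_oddPlus]
        have h3 : (2 * ((N + 1 : ℕ) : ℝ)) ≠ 0 := by positivity
        have h4 : (2 * ((N + 1 : ℕ) : ℝ) + 1) ≠ 0 := by positivity
        field_simp
        ring
      have h5 : oddSum (stdSeq L) (N + 1) = LinForm.oddPlus.recip (N + 1) *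
          (prefixSum .ge (stdSeq L) N + stdSeq L (N + 1)) := by
        rw [oddSum, sum_range_succ]
        rfl
      simp only [Pi.mul_apply, prefixSum_gt_succ]
      rw [h2, h5]
      linear_combination h1
  have hlim : Filter.Tendsto (fun N => bCoeff N * oddSum (stdSeq L) N) Filter.atTop (nhds 0) :=
    (decays_bCoeff.mul hL.decays.oddSum).tendsto_zero (by norm_num)
  have h1 := ((Filter.tendsto_add_atTop_iff_nat 1).2 (hsum.hasSum.sub hS).tendsto_sum_nat)
  simp only [key] at h1
  have h2 := tendsto_nhds_unique h1 hlim.neg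
  rw [neg_zero, sub_eq_zero] at h2
  exact h2 ▸ hsum.hasSum

/-- This instance handles the outermost index: `e = 1` demands exponent 2 for convergence and grants
an outer 2n - 1 one extra unit of weight. -/
theorem isTarget_gaussianValued : IsTarget 1 gaussianValued where
  le_one := le_rfl
  mono w w' h := fun A ⟨S, hS, hS'⟩ => ⟨S, hS, CMZVLeGaussian_mono 4 h hS'⟩
  single_mem := by
    refine ⟨1, ?_, Submodule.subset_span ⟨0, le_rfl, by simpa using isCMZV_one 4⟩⟩
    convert hasSum_single (f := fun n => bCoeff n * (Pi.single 0 1 : ℕ → ℝ) n) 0 ?_ using 1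
    · simp
    · intro n hn; simp [hn]
  std_mem {l s L} hL hs := by
    by_cases hl : l = .oddMinus
    · subst hl
      exact stdSeq_oddMinus_mem hL hs
    · have h1 := (plain_cons.2 ⟨⟨hl, by omega⟩, hL⟩ : Plain ((l, s) :: L)).stdSeq_mem_gaussianValued
        hs
      have h2 : l.nu = 0 := by rcases l with _ | _ | _ <;> first | rfl | exact absurd rfl hl
      simpa [h2] using h1
  prod_mem {L} hL h l l' hl := by
    have h12 : LinForm.even.recip * LinForm.oddPlus.recip * prefixSum .gt (stdSeq L) ∈
        gaussianValued (listWeight L + 2) := by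
      obtain ⟨S, hS, hS'⟩ := h
      exact ⟨S, hasSum_even_mul_oddPlus hL hS, CMZVLeGaussian_mono 4 (Nat.le_succ _) hS'⟩
    have h13 := even_mul_oddMinus_mem hL
    have h23 : LinForm.oddPlus.recip * LinForm.oddMinus.recip * prefixSum .gt (stdSeq L) ∈
        gaussianValued (listWeight L + 2) := by
      -- Half the sum of the two products already evaluated, since 1/(2n+1) + 1/(2n-1) = 4n /
      -- ((2n+1)(2n-1)).
      have h1 : LinForm.oddPlus.recip * LinForm.oddMinus.recip * prefixSum .gt (stdSeq L) =
          (1 / 2 : ℚ) • (LinForm.even.recip * LinForm.oddPlus.recip * prefixSum .gt (stdSeq L) +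
            LinForm.even.recip * LinForm.oddMinus.recip * prefixSum .gt (stdSeq L)) := by
        ext n
        rcases n with _ | n
        · simp [prefixSum_gt_zero]
        · have h2 : (2 * (n + 1) - 1 : ℝ) ≠ 0 := by
            have : (0 : ℝ) ≤ n := n.cast_nonneg
            linarith
          have h3 : (n + 1 : ℝ) ≠ 0 := by positivity
          have h4 : (2 * (n + 1) + 1 : ℝ) ≠ 0 := by positivity
          simp only [Pi.mul_apply, Pi.smul_apply, Pi.add_apply, Rat.smul_def,
            LinForm.recip_even, LinForm.recip_oddPlus, LinForm.recip_oddMinus]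
          push_cast
          field_simp
          ring
      rw [h1]
      exact Submodule.smul_mem _ _ (add_mem h12 h13)
    rcases l with _ | _ | _ <;> rcases l' with _ | _ | _ <;>
      first
        | exact absurd rfl hl
        | exact h12
        | exact h13
        | exact h23
        | (rw [mul_comm (LinForm.recip _)]; exact h12)
        | (rw [mul_comm (LinForm.recip _)]; exact h13)
        | (rw [mul_comm (LinForm.recip _)]; exact h23)

theorem chainSeq_mem_gaussianValued {l : LinForm} {r : IneqSign} {s : ℕ}
    {R : List (LinForm × IneqSign × ℕ)} (hs : 2 ≤ s) (hR : ∀ p ∈ R, 1 ≤ p.2.2) :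
    chainSeq (formChain ((l, r, s) :: R)) ∈
      gaussianValued ((R.map fun p => p.2.2).sum + s + l.nu) := by
  rw [chainSeq_formChain_cons]
  simpa using isTarget_gaussianValued.mul_prefixSum_mem (chainSeq_mem_nearStdSpan hR) l hs r

end Values

/-! ### Exact weight when no 2n - 1 follows 2n -/

section ExactWeight

/-- The span of the standard sequences of weight `w` whose outermost entry is `2n + 1`, with
exponent at least `k`. -/
noncomputable def oddSpan (k w : ℕ) : Submodule ℚ (ℕ → ℝ) :=
  Submodule.span ℚ {A | ∃ s L, k ≤ s ∧ Plain ((.oddPlus, s) :: L) ∧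
    listWeight ((.oddPlus, s) :: L) = w ∧ A = stdSeq ((.oddPlus, s) :: L)}

/-- The span of the standard sequences of weight `w`. -/
noncomputable def stdSpan (w : ℕ) : Submodule ℚ (ℕ → ℝ) :=
  Submodule.span ℚ {A | ∃ L, Plain L ∧ listWeight L = w ∧ A = stdSeq L}

theorem oddSpan_le_stdSpan (k w : ℕ) : oddSpan k w ≤ stdSpan w :=
  Submodule.span_mono fun _ ⟨_, _, _, h⟩ => ⟨_, h⟩

theorem oddPlus_mul_prefixSum_ge_mem {s w : ℕ} (hs : 1 ≤ s) {A : ℕ → ℝ} (hA : A ∈ stdSpan w) :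
    LinForm.oddPlus.recip ^ s * prefixSum .ge A ∈ oddSpan s (s + w) := by
  induction hA using Submodule.span_induction with
  | mem A hA =>
    obtain ⟨L, hL, rfl, rfl⟩ := hA
    exact Submodule.subset_span ⟨s, L, le_rfl, plain_oddPlus hs hL, listWeight_cons _ _ _, rfl⟩
  | zero => simp
  | add A B _ _ hA hB => rw [map_add, mul_add]; exact add_mem hA hB
  | smul q A _ hA => rw [map_smul, mul_smul_comm]; exact Submodule.smul_mem _ _ hA

theorem even_mul_prefixSum_gt_mem {s w : ℕ} (hs : 1 ≤ s) {A : ℕ → ℝ} (hA : A ∈ stdSpan w) :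
    LinForm.even.recip ^ s * prefixSum .gt A ∈ stdSpan (s + w) := by
  induction hA using Submodule.span_induction with
  | mem A hA =>
    obtain ⟨L, hL, rfl, rfl⟩ := hA
    exact Submodule.subset_span ⟨(.even, s) :: L, plain_even hs hL, listWeight_cons _ _ _, rfl⟩
  | zero => simp
  | add A B _ _ hA hB => rw [map_add, mul_add]; exact add_mem hA hB
  | smul q A _ hA => rw [map_smul, mul_smul_comm]; exact Submodule.smul_mem _ _ hA

theorem oddPlus_mul_mem {s k w : ℕ} {A : ℕ → ℝ} (hA : A ∈ oddSpan k w) :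
    LinForm.oddPlus.recip ^ s * A ∈ oddSpan (s + k) (s + w) := by
  induction hA using Submodule.span_induction with
  | mem A hA =>
    obtain ⟨t, L, ht, hL, rfl, rfl⟩ := hA
    refine Submodule.subset_span ⟨s + t, L, by omega, ?_, ?_, ?_⟩
    · obtain ⟨⟨-, h1⟩, h2⟩ := plain_cons.1 hL
      exact plain_oddPlus (by omega) h2
    · simp only [listWeight_cons, add_assoc]
    · rw [stdSeq_cons_eq, stdSeq_cons_eq, pow_add, mul_assoc]
  | zero => simp
  | add A B _ _ hA hB => rw [mul_add]; exact add_mem hA hB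
  | smul q A _ hA => rw [mul_smul_comm]; exact Submodule.smul_mem _ _ hA

theorem oddSpan_anti {k k' w : ℕ} (h : k ≤ k') : oddSpan k' w ≤ oddSpan k w :=
  Submodule.span_mono fun _ ⟨s, L, hs, h'⟩ => ⟨s, L, h.trans hs, h'⟩

theorem head?_ne_oddMinus {s : ℕ} {R : List (LinForm × ℕ)}
    (hR : ((.even, s) :: R).IsChain fun p q => q.1 = .oddMinus → p.1 ≠ .even) :
    R.head?.map Prod.fst ≠ some .oddMinus := by
  rcases R with _ | ⟨q, R⟩
  · simp
  · rw [List.isChain_cons_cons] at hR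
    intro h
    exact hR.1 (by simpa using h) rfl

/-- Both claims are proved together: a 2n in front needs the tail itself to be standard, while 2n ±
1 in front needs only the tail after one more factor 2n + 1. No partial fractions occur, so the
weight is exact. -/
theorem oddPlus_mul_prefixSum_ge_stdSeq_mem {R : List (LinForm × ℕ)} (hs : ∀ p ∈ R, 1 ≤ p.2)
    (hR : R.IsChain fun p q => q.1 = .oddMinus → p.1 ≠ .even) :
    (R.head?.map Prod.fst ≠ some .oddMinus → stdSeq R ∈ stdSpan (listWeight R)) ∧
    ∀ s : ℕ, 1 ≤ s →
      LinForm.oddPlus.recip ^ s * prefixSum .ge (stdSeq R) ∈ oddSpan s (s + listWeight R) := by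
  induction R with
  | nil =>
    have h1 : stdSeq [] ∈ stdSpan (listWeight []) :=
      Submodule.subset_span ⟨[], plain_nil, rfl, rfl⟩
    exact ⟨fun _ => h1, fun s hs => oddPlus_mul_prefixSum_ge_mem hs h1⟩
  | cons p R ih =>
    obtain ⟨l, t⟩ := p
    obtain ⟨ih1, ih2⟩ := ih (fun q hq => hs q (by simp [hq])) hR.tail
    have ht : 1 ≤ t := hs (l, t) (by simp)
    have ih3 := ih2 t ht
    rw [← listWeight_cons l] at ih3
    rcases l with _ | _ | _
    · have h2 := even_mul_prefixSum_gt_mem ht (ih1 (head?_ne_oddMinus hR))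
      rw [← listWeight_cons .even] at h2
      exact ⟨fun _ => h2, fun s hs => oddPlus_mul_prefixSum_ge_mem hs h2⟩
    · have h2 := oddSpan_le_stdSpan _ _ ih3
      exact ⟨fun _ => h2, fun s hs => oddPlus_mul_prefixSum_ge_mem hs h2⟩
    · refine ⟨fun h => absurd rfl h, fun s hs => ?_⟩
      rw [stdSeq_cons_eq]
      simp only [LinForm.sign]
      -- After the shift the sign is >, that is ≥ minus the diagonal; on the diagonal two powers of
      -- the same form 2n + 1 merge.
      have h3 : prefixSum .gt (LinForm.oddPlus.recip ^ t * prefixSum .ge (stdSeq R)) =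
          prefixSum .ge (LinForm.oddPlus.recip ^ t * prefixSum .ge (stdSeq R)) -
          LinForm.oddPlus.recip ^ t * prefixSum .ge (stdSeq R) := by
        rw [prefixSum_ge (LinForm.oddPlus.recip ^ t * _), add_sub_cancel_right]
      rw [prefixSum_ge_oddMinus, h3, mul_sub]
      exact sub_mem (oddPlus_mul_prefixSum_ge_mem hs (oddSpan_le_stdSpan _ _ ih3))
        (oddSpan_anti (Nat.le_add_right _ _) (oddPlus_mul_mem ih3))

/-- The sequences `A` for which `∑ b_n A_n` converges to an element of `i ^ k CMZV_w^4`. -/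
noncomputable def exactValued (k w : ℕ) : Submodule ℚ (ℕ → ℝ) where
  carrier := {A | ∃ S : ℝ, HasSum (fun n => bCoeff n * A n) S ∧
    ∃ u ∈ CMZV 4 w, (S : ℂ) = Complex.I ^ k * u}
  zero_mem' := ⟨0, by simp, 0, zero_mem _, by simp⟩
  add_mem' := by
    rintro A B ⟨S, hS, u, hu, h⟩ ⟨S', hS', u', hu', h'⟩
    exact ⟨S + S', by simpa [mul_add] using hS.add hS', u + u', add_mem hu hu', by
      rw [Complex.ofReal_add, h, h', mul_add]⟩
  smul_mem' := by
    rintro q A ⟨S, hS, u, hu, h⟩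
    refine ⟨q * S, ?_, q • u, Submodule.smul_mem _ _ hu, ?_⟩
    · simpa [Rat.smul_def, mul_left_comm] using hS.mul_left (q : ℝ)
    · rw [Rat.smul_def, Complex.ofReal_mul, h, Complex.ofReal_ratCast, mul_left_comm]

theorem oddSpan_le_exactValued {s : ℕ} (hs : 2 ≤ s) (w : ℕ) : oddSpan s w ≤ exactValued 1 w := by
  refine Submodule.span_le.2 ?_
  rintro _ ⟨t, L, ht, hL, rfl, rfl⟩
  exact hL.exists_hasSum (hs.trans ht)

theorem even_mul_prefixSum_gt_mem_exactValued {s w : ℕ} (hs : 2 ≤ s) {A : ℕ → ℝ}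
    (hA : A ∈ stdSpan w) :
    LinForm.even.recip ^ s * prefixSum .gt A ∈ exactValued 0 (s + w) := by
  induction hA using Submodule.span_induction with
  | mem A hA =>
    obtain ⟨L, hL, rfl, rfl⟩ := hA
    rw [← listWeight_cons .even]
    exact (plain_even (by omega) hL).exists_hasSum hs
  | zero => simp
  | add A B _ _ hA hB => rw [map_add, mul_add]; exact add_mem hA hB
  | smul q A _ hA => rw [map_smul, mul_smul_comm]; exact Submodule.smul_mem _ _ hA

/-- An outer 2n - 1 is shifted to 2n + 1, and b_{n+1} = b_n + b_n/(2n+1) gives the two weights. -/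
theorem exists_hasSum_stdSeq {l : LinForm} {s : ℕ} {R : List (LinForm × ℕ)} (h2 : 2 ≤ s)
    (hs : ∀ p ∈ R, 1 ≤ p.2)
    (hR : ((l, s) :: R).IsChain fun p q => q.1 = .oddMinus → p.1 ≠ .even) :
    ∃ S : ℝ, HasSum (fun n => bCoeff n * stdSeq ((l, s) :: R) n) S ∧
      ∃ u ∈ CMZV 4 (s + listWeight R), ∃ v ∈ CMZV 4 (s + listWeight R + 1),
        (S : ℂ) = Complex.I ^ l.delta * (u + l.nu * v) := by
  obtain ⟨h3, h4⟩ := oddPlus_mul_prefixSum_ge_stdSeq_mem hs hR.tail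
  rcases l with _ | _ | _
  · obtain ⟨S, hS, u, hu, h⟩ :=
      even_mul_prefixSum_gt_mem_exactValued h2 (h3 (head?_ne_oddMinus hR))
    exact ⟨S, hS, u, hu, 0, zero_mem _, by simpa [LinForm.nu, LinForm.delta] using h⟩
  · obtain ⟨S, hS, u, hu, h⟩ := oddSpan_le_exactValued h2 _ (h4 s (by omega))
    exact ⟨S, hS, u, hu, 0, zero_mem _, by simpa [LinForm.nu, LinForm.delta] using h⟩
  · obtain ⟨S, hS, u, hu, h⟩ := oddSpan_le_exactValued h2 _ (h4 s (by omega))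
    obtain ⟨S', hS', v, hv, h'⟩ :=
      oddSpan_le_exactValued (s := s + 1) (by omega) _ (h4 (s + 1) (by omega))
    rw [add_right_comm] at hv
    refine ⟨S + S', hasSum_oddMinus hS hS', u, hu, v, hv, ?_⟩
    rw [Complex.ofReal_add, h, h']
    simp [LinForm.delta, LinForm.nu, mul_add]

end ExactWeight

/-! ### Assembly of the four statements -/

theorem mainTheorem1 {d : ℕ} (hd : 0 < d) (s : Fin d → ℕ) (hs : ∀ j, 1 ≤ s j)
    (hs1 : 2 ≤ s ⟨0, hd⟩) (l : Fin d → LinForm) :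
    -- (a) only `2n` and `2n + 1` occur
    ((∀ j, l j = .even ∨ l j = .oddPlus) →
      ∃ S : ℝ, HasAperySum hd s l (fun j => (l j).sign) S ∧
        ∃ u ∈ CMZV 4 (∑ j, s j), (S : ℂ) = Complex.I ^ (l ⟨0, hd⟩).delta * u) ∧
    -- (b) no `2n - 1` is immediately preceded by `2n`
    ((∀ (j : ℕ) (hj : j + 1 < d), l ⟨j + 1, hj⟩ = .oddMinus → l ⟨j, by omega⟩ ≠ .even) →
      ∃ S : ℝ, HasAperySum hd s l (fun j => (l j).sign) S ∧
        ∃ u ∈ CMZV 4 (∑ j, s j), ∃ v ∈ CMZV 4 ((∑ j, s j) + 1),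
          (S : ℂ) = Complex.I ^ (l ⟨0, hd⟩).delta * (u + (l ⟨0, hd⟩).nu * v)) ∧
    -- (c) arbitrary linear forms
    (∃ S : ℝ, HasAperySum hd s l (fun j => (l j).sign) S ∧
      (S : ℂ) ∈ CMZVLeGaussian 4 ((∑ j, s j) + (l ⟨0, hd⟩).nu)) ∧
    -- (d) arbitrary linear forms and arbitrary inequality signs
    (∀ r : Fin d → IneqSign, AperyDefined l r →
      ∃ S : ℝ, HasAperySum hd s l r S ∧
        (S : ℂ) ∈ CMZVLeGaussian 4 ((∑ j, s j) + (l ⟨0, hd⟩).nu)) := by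
  obtain ⟨k, rfl⟩ : ∃ k, d = k + 1 := ⟨d - 1, by omega⟩
  have hzero : (⟨0, hd⟩ : Fin (k + 1)) = 0 := rfl
  have general : ∀ r : Fin (k + 1) → IneqSign, ∃ S : ℝ, HasAperySum hd s l r S ∧
      (S : ℂ) ∈ CMZVLeGaussian 4 ((∑ j, s j) + (l ⟨0, hd⟩).nu) := by
    intro r
    have h1 := hasAperySum_tsum hd s hs hs1 l r
    refine ⟨_, h1, ?_⟩
    rw [List.ofFn_succ]
    obtain ⟨S, hS, h⟩ := chainSeq_mem_gaussianValued (l := l 0) (r := r 0) (s := s 0)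
      (R := List.ofFn fun j : Fin k => (l j.succ, r j.succ, s j.succ)) hs1 (fun p hp => by
        obtain ⟨j, rfl⟩ := (List.mem_ofFn' _ _).1 hp
        exact hs j.succ)
    rw [hS.tsum_eq, Fin.sum_univ_succ, hzero]
    rw [List.map_ofFn, List.sum_ofFn, add_comm (∑ i, _)] at h
    exact h
  have exact : (∀ (j : ℕ) (hj : j + 1 < k + 1), l ⟨j + 1, hj⟩ = .oddMinus →
      l ⟨j, by omega⟩ ≠ .even) → ∃ S : ℝ, HasAperySum hd s l (fun j => (l j).sign) S ∧
        ∃ u ∈ CMZV 4 (∑ j, s j), ∃ v ∈ CMZV 4 ((∑ j, s j) + 1),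
          (S : ℂ) = Complex.I ^ (l ⟨0, hd⟩).delta * (u + (l ⟨0, hd⟩).nu * v) := by
    intro hl
    have h1 := hasAperySum_tsum hd s hs hs1 l (fun j => (l j).sign)
    have h2 : formChain (List.ofFn fun j => (l j, (l j).sign, s j)) = formChain
        (((l 0, s 0) :: List.ofFn fun j : Fin k => (l j.succ, s j.succ)).map
          fun p => (p.1, p.1.sign, p.2)) := by
      rw [← List.ofFn_succ (f := fun j => (l j, s j)), List.map_ofFn]
      rfl
    obtain ⟨S, hS, u, hu, v, hv, h⟩ := exists_hasSum_stdSeq (l := l 0) (s := s 0)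
      (R := List.ofFn fun j : Fin k => (l j.succ, s j.succ)) hs1 (fun p hp => by
        obtain ⟨j, rfl⟩ := (List.mem_ofFn' _ _).1 hp
        exact hs j.succ) (by
        rw [← List.ofFn_succ (f := fun j => (l j, s j)), List.isChain_iff_getElem]
        intro i hi
        simp only [List.length_ofFn] at hi
        simp only [List.getElem_ofFn]
        exact hl i hi)
    have h3 : s 0 + listWeight (List.ofFn fun j : Fin k => (l j.succ, s j.succ)) = ∑ j, s j := by
      rw [listWeight, List.map_ofFn, List.sum_ofFn, Fin.sum_univ_succ]
      rfl
    rw [h3] at hu hv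
    refine ⟨S, ?_, u, hu, v, hv, h⟩
    rw [h2] at h1
    rwa [← hS.tsum_eq]
  refine ⟨fun h => ?_, exact, general _, fun r _ => general r⟩
  -- Without 2n - 1 the condition of (b) is vacuous and ν = 0 removes the term of higher weight.
  obtain ⟨S, hS, u, hu, v, -, hSu⟩ := exact fun j hj h' => by
    rcases h ⟨j + 1, hj⟩ with h1 | h1 <;> rw [h'] at h1 <;> cases h1
  refine ⟨S, hS, u, hu, ?_⟩
  rcases h ⟨0, hd⟩ with h1 | h1 <;>
    rw [h1] at hSu ⊢ <;> simpa [LinForm.nu] using hSu
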